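/- Let $d\ge 2$, let $K\subset\mathbb R^d$ be a strictly convex origin-symmetric convex body (compact, with non-empty interior), and for $x\in\partial K$ let $\nu(x)$ be an outward unit normal vector to $K$ at $x$ (it is unique for $\mathcal H^{d-1}$-almost every $x\in\partial K$; at the remaining points any choice is allowed). Here $\mathcal H^{d-1}$ is the $(d-1)$-dimensional Hausdorff measure, normalised to agree with Lebesgue measure on hyperplanes. Let $\omega_{d-1}$ be the volume of the unit ball of $\mathbb R^{d-1}$, let $m_d$ be Lebesgue measure on $\mathbb R^d$, and let $K^\circ=\{y\in\mathbb R^d:\langle x,y\rangle\le 1\text{ for every }x\in K\}$. Let $\mathcal{PW}_\infty(K)$ be the space of functions in $L^\infty(\mathbb R^d)$ whose distributional Fourier transform (with kernel $e^{2\pi i\langle x,\xi\rangle}$) is supported in $K$, each identified with its continuous representative. For a set $\Gamma\subset\mathbb R^d$ put $$\mathbf D^-(\Gamma)=\liminf_{r\to\infty}\ \inf_{x\in\mathbb R^d}\frac{\mathcal H^{d-1}(\Gamma\cap B(x,r))}{m_d(B(x,r))},$$ and, for $\varphi:[0,\infty)\to[0,\infty)$, call $\Gamma$ $\varphi$-regular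 if it is closed and $\mathcal H^{d-1}(\Gamma\cap B(x,r))\le\varphi(r)\,\omega_{d-1}r^{d-1}$ for all $x\in\mathbb R^d$ and all $r\in(0,1)$. Let $g:\partial K\to[0,\infty)$ be bounded and continuous, and set $$\langle g\rangle=\frac1{\mathcal H^{d-1}(\partial K)}\int_{\partial K}g\,d\mathcal H^{d-1},\qquad \mu=\frac1{\mathcal H^{d-1}(\partial K)}\sup_{y\in K^\circ}\int_{\partial K}|\langle\nu(x),y\rangle|\,g(x)\,d\mathcal H^{d-1}(x).$$ Then for every $\varepsilon>0$ there are a function $f\in\mathcal{PW}_\infty(K)$ with $|f(0)|=\|f\|_\infty=1$, a continuous function $\varphi:[0,\infty)\to[0,\infty)$ with $\varphi(0)=1$, and a $\varphi$-regular set $\Gamma\subset\{f=0\}$ such that $$\mathbf D^-(\Gamma)\ \ge\ \frac{2\langle g\rangle}{\mu}-\varepsilon$$ (if $g\equiv0$, the quotient $2\langle g\rangle/\mu$ is read as $0$). Moreover, $f$ can be taken of the form $$f(x)=\prod_{n=1}^N\cos\Bigl(2\pi\,\frac{\alpha\, g(x_n)}{N}\,\langle x,\nu(x_n)\rangle\Bigr)$$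 for some $N\ge1$, some $\alpha>0$ and some points $x_1,\dots,x_N\in\partial K$. -/

import Mathlib

open MeasureTheory Filter Topology SchwartzMap
open scoped NNReal ENNReal FourierTransform RealInnerProductSpace

/-- `v` is an outward unit normal vector to the convex set `K` at the point `x`. -/
def IsOutwardUnitNormal {d : ℕ} (K : Set (EuclideanSpace ℝ (Fin d)))
    (x v : EuclideanSpace ℝ (Fin d)) : Prop :=
  ‖v‖ = 1 ∧ ∀ y ∈ K, ⟪y - x, v⟫ ≤ 0

/-- The polar body `K° = {y : ⟨x, y⟩ ≤ 1 for every x ∈ K}`. -/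
def polarBody {d : ℕ} (K : Set (EuclideanSpace ℝ (Fin d))) : Set (EuclideanSpace ℝ (Fin d)) :=
  {y | ∀ x ∈ K, ⟪x, y⟫ ≤ 1}

/-- The Paley-Wiener space `PW_∞(K)`: functions in `L^∞(ℝ^d)` whose distributional Fourier
transform is supported in `K`. Each element is represented by its continuous representative, so
that its values at points and its zero set are meaningful. The kernel of the Fourier transform is
`exp(2πi⟨x, ξ⟩)`, which is Mathlib's `𝓕⁻`. -/
def paleyWienerInfty {d : ℕ} (K : Set (EuclideanSpace ℝ (Fin d))) :
    Set (EuclideanSpace ℝ (Fin d) → ℂ) :=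
  {f | Continuous f ∧ ∃ hf : MemLp f ∞ volume,
    Distribution.dsupport
      (𝓕⁻ (Lp.toTemperedDistribution (hf.toLp f) : 𝓢'(EuclideanSpace ℝ (Fin d), ℂ)) :
        𝓢'(EuclideanSpace ℝ (Fin d), ℂ)) ⊆ K}

/-- The lower surface density
`D⁻(Γ) = liminf_{r → ∞} inf_x H^{d-1}(Γ ∩ B(x, r)) / m_d(B(x, r))`. The measure `μHE[d - 1]` is
the `(d - 1)`-dimensional Hausdorff measure, normalised to agree with Lebesgue measure on
hyperplanes. -/
noncomputable def lowerSurfaceDensity {d : ℕ} (Γ : Set (EuclideanSpace ℝ (Fin d))) : ℝ≥0∞ :=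
  liminf (fun r : ℝ => ⨅ x : EuclideanSpace ℝ (Fin d),
    μHE[d - 1] (Γ ∩ Metric.ball x r) / volume (Metric.ball x r)) atTop

/-- The volume `ω_k` of the unit ball of `ℝ^k`. -/
noncomputable def unitBallVolume (k : ℕ) : ℝ≥0∞ :=
  volume (Metric.ball (0 : EuclideanSpace ℝ (Fin k)) 1)

/-- A set `Γ ⊆ ℝ^d` is `φ`-regular if it is closed and
`H^{d-1}(Γ ∩ B(x, r)) ≤ φ(r) ω_{d-1} r^{d-1}` for all `x` and all `r ∈ (0, 1)`. -/
def IsPhiRegular {d : ℕ} (φ : ℝ≥0 → ℝ≥0) (Γ : Set (EuclideanSpace ℝ (Fin d))) : Prop :=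
  IsClosed Γ ∧ ∀ (x : EuclideanSpace ℝ (Fin d)) (r : ℝ≥0), 0 < r → r < 1 →
    μHE[d - 1] (Γ ∩ Metric.ball x (r : ℝ)) ≤
      (φ r : ℝ≥0∞) * unitBallVolume (d - 1) * (r : ℝ≥0∞) ^ (d - 1)

/-- The mean `⟨g⟩` of `g` over `∂K` with respect to normalised surface measure. -/
noncomputable def surfaceMean {d : ℕ} (K : Set (EuclideanSpace ℝ (Fin d)))
    (g : EuclideanSpace ℝ (Fin d) → ℝ) : ℝ :=
  ⨍ x in frontier K, g x ∂μHE[d - 1]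

/-- The quantity `μ = H^{d-1}(∂K)⁻¹ sup_{y ∈ K°} ∫_{∂K} |⟨ν(x), y⟩| g(x) dH^{d-1}(x)`. -/
noncomputable def polarSup {d : ℕ} (K : Set (EuclideanSpace ℝ (Fin d)))
    (ν : EuclideanSpace ℝ (Fin d) → EuclideanSpace ℝ (Fin d))
    (g : EuclideanSpace ℝ (Fin d) → ℝ) : ℝ :=
  ((μHE[d - 1] : Measure (EuclideanSpace ℝ (Fin d))).real (frontier K))⁻¹ *
    ⨆ y : polarBody K, ∫ x in frontier K, |⟪ν x, (y : EuclideanSpace ℝ (Fin d))⟫| * g x ∂μHE[d - 1]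

/-! ### Fubini over parallel hyperplanes, and the area of a hyperplane inside a ball. -/

section Hyperplanes

variable {d : ℕ}

/-! The surface measure of $\partial K$ is replaced by finitely many random points. For
$x_1,\dots,x_N\in\partial K$ put $\xi_n=\alpha g(x_n)\nu(x_n)/N$. The product of the
$\cos(2\pi\langle x,\xi_n\rangle)$ has its spectrum among the signed sums $\sum\pm\xi_n$. By the
bipolar theorem these lie in $K$ once $\sum|\langle\xi_n,y\rangle|\le1$ on $K^\circ$, i.e. once
$\alpha$ times the sample mean of $|\langle\nu,y\rangle|g$ is at most 1 there. The product vanishes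
on families of parallel hyperplanes, the $n$-th with spacing $N/(2\alpha g(x_n))$, so the total
density is $2\alpha$ times the sample mean of $g$.

For independent points with the normalised surface measure as law, the law of large numbers, in
$\mathbb R$ and in $C(K^\circ)$, puts the mean of $g$ near $\langle g\rangle$ and the other means
below $\mu+\eta$ uniformly in $y$ (`exists_sample_points`). Hence $\alpha=1/(\mu+\eta)$ is
admissible and the density is nearly $2\langle g\rangle/\mu$. Measurability of $\nu$ comes from its
being almost everywhere the normalised gradient of the gauge.

Regularity with $\varphi(0)=1$ fails where hyperplanes cross. Almost surely the points are distinct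
up to sign, so strict convexity and symmetry make the normals pairwise non-parallel. Deleting from
each family thin slabs about the others leaves a set that is locally part of one hyperplane
(`thinnedGrid_isPhiRegular`), at an arbitrarily small cost in density
(`exists_thinnedGrid_density`). -/

theorem mem_mk'_orthogonal_span_iff {u : EuclideanSpace ℝ (Fin d)} (hu : ‖u‖ = 1) (t : ℝ)
    (x : EuclideanSpace ℝ (Fin d)) :
    x ∈ AffineSubspace.mk' (t • u +ᵥ (0 : EuclideanSpace ℝ (Fin d))) (ℝ ∙ u)ᗮ ↔ ⟪x, u⟫ = t := by
  rw [AffineSubspace.mem_mk', Submodule.mem_orthogonal_singleton_iff_inner_left]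
  simp [inner_sub_left, inner_smul_left, hu, sub_eq_zero]

/-- Fubini's theorem for slices by parallel hyperplanes. -/
theorem volume_eq_lintegral_hyperplane {u : EuclideanSpace ℝ (Fin d)} (hu : ‖u‖ = 1)
    {S : Set (EuclideanSpace ℝ (Fin d))} (hS : MeasurableSet S) :
    volume S = ∫⁻ t : ℝ, μHE[d - 1] (S ∩ {x | ⟪x, u⟫ = t}) := by
  have hu0 : u ≠ 0 := by rintro rfl; simp at hu
  have h := EuclideanGeometry.euclideanHausdorffMeasure_eq_lintegral
    (0 : EuclideanSpace ℝ (Fin d)) hu0 hS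
  have hd : Module.finrank ℝ (EuclideanSpace ℝ (Fin d)) = d := by simp
  rw [hd, EuclideanSpace.euclideanHausdorffMeasure_eq_volume] at h
  have he : ‖u‖ₑ = 1 := by simp [← ofReal_norm, hu]
  rw [h, he, one_mul]
  congr with t
  congr 2
  ext x
  exact mem_mk'_orthogonal_span_iff hu t x

/-- By Pythagoras, the section lies in the $(d-1)$-ball of radius $r$ about the projection of $x$
onto the hyperplane. The sharp constant is what allows $\varphi(0)=1$. -/
theorem euclideanHausdorffMeasure_ball_inter_hyperplane_le {u : EuclideanSpace ℝ (Fin d)}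
    (hu : ‖u‖ = 1) (t : ℝ) (x : EuclideanSpace ℝ (Fin d)) {r : ℝ≥0} (hr : 0 < r) :
    μHE[d - 1] ({y | ⟪y, u⟫ = t} ∩ Metric.ball x (r : ℝ)) ≤
      unitBallVolume (d - 1) * (r : ℝ≥0∞) ^ (d - 1) := by
  have hu0 : u ≠ 0 := by rintro rfl; simp at hu
  let W := (ℝ ∙ u)ᗮ
  have hW : Module.finrank ℝ W = d - 1 := by
    have := (ℝ ∙ u).finrank_add_finrank_orthogonal
    rw [finrank_span_singleton hu0] at this
    simp at this
    change 1 + Module.finrank ℝ W = d at this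
    omega
  let e := ((stdOrthonormalBasis ℝ W).reindex (finCongr hW)).repr.symm
  let c : EuclideanSpace ℝ (Fin d) := x + (t - ⟪x, u⟫) • u
  let F : EuclideanSpace ℝ (Fin (d - 1)) → EuclideanSpace ℝ (Fin d) := fun y => c + (e y : W)
  have hF : Isometry F := by
    have h1 : Isometry (fun y => ((e y : W) : EuclideanSpace ℝ (Fin d))) :=
      isometry_subtype_coe.comp e.isometry
    exact (IsometryEquiv.addLeft c).isometry.comp h1
  have hsub : {y | ⟪y, u⟫ = t} ∩ Metric.ball x (r : ℝ) ⊆ F '' Metric.ball 0 (r : ℝ) := by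
    rintro y ⟨hy, hyr⟩
    have hc : ⟪c, u⟫ = t := by
      simp [c, inner_add_left, inner_smul_left, hu]
    have hmem : y - c ∈ W := by
      rw [Submodule.mem_orthogonal_singleton_iff_inner_left, inner_sub_left, hc]
      simpa [sub_eq_zero] using hy
    refine ⟨e.symm ⟨y - c, hmem⟩, ?_, by simp [F]⟩
    rw [mem_ball_zero_iff, LinearIsometryEquiv.norm_map]
    rw [Metric.mem_ball, dist_eq_norm] at hyr
    refine lt_of_le_of_lt ?_ hyr
    change ‖y - c‖ ≤ ‖y - x‖
    have hyx : y - x = (y - c) + (t - ⟪x, u⟫) • u := by simp only [c]; abel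
    have hor : ⟪y - c, (t - ⟪x, u⟫) • u⟫ = 0 := by
      rw [inner_smul_right, (Submodule.mem_orthogonal_singleton_iff_inner_left).1 hmem, mul_zero]
    have := norm_add_sq_eq_norm_sq_add_norm_sq_of_inner_eq_zero _ _ hor
    rw [← hyx] at this
    nlinarith [norm_nonneg (y - x), norm_nonneg (y - c), norm_nonneg ((t - ⟪x, u⟫) • u)]
  refine (measure_mono hsub).trans ?_
  rw [hF.euclideanHausdorffMeasure_image, EuclideanSpace.euclideanHausdorffMeasure_eq_volume]
  rw [Measure.addHaar_ball_of_pos _ _ (by exact_mod_cast hr), unitBallVolume]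
  simp [mul_comm]

theorem unitBallVolume_ne_zero (k : ℕ) : unitBallVolume k ≠ 0 :=
  (Metric.measure_ball_pos _ _ one_pos).ne'

theorem unitBallVolume_ne_top (k : ℕ) : unitBallVolume k ≠ ∞ :=
  measure_ball_lt_top.ne

theorem euclideanHausdorffMeasure_image_add_right (k : ℕ) (v : EuclideanSpace ℝ (Fin d))
    (s : Set (EuclideanSpace ℝ (Fin d))) :
    μHE[k] ((fun x => x + v) '' s) = μHE[k] s :=
  (IsometryEquiv.addRight v).isometry.euclideanHausdorffMeasure_image s

end Hyperplanes

/-! ### Area and volume estimates for periodic families of hyperplanes and slabs. -/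

section HyperplaneFamilies

variable {d : ℕ}

/-- The family of parallel hyperplanes `⟨x, u⟩ = (k + 1/2) s`, `k ∈ ℤ`. -/
def hyperplaneFamily (u : EuclideanSpace ℝ (Fin d)) (s : ℝ) : Set (EuclideanSpace ℝ (Fin d)) :=
  {x | ∃ k : ℤ, ⟪x, u⟫ = (k + 1 / 2) * s}

/-- The open slabs of half-width `δ` about the hyperplanes of a family. -/
def slabFamily (u : EuclideanSpace ℝ (Fin d)) (s δ : ℝ) : Set (EuclideanSpace ℝ (Fin d)) :=
  {x | ∃ k : ℤ, |⟪x, u⟫ - (k + 1 / 2) * s| < δ}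

/-- The signed height of `x` above the hyperplane of the family in whose cell it lies. -/
noncomputable def cellHeight (u : EuclideanSpace ℝ (Fin d)) (s : ℝ)
    (x : EuclideanSpace ℝ (Fin d)) : ℝ :=
  ⟪x, u⟫ - (⌊⟪x, u⟫ / s⌋ + 1 / 2) * s

theorem abs_cellHeight_le (u : EuclideanSpace ℝ (Fin d)) {s : ℝ} (hs : 0 < s)
    (x : EuclideanSpace ℝ (Fin d)) : |cellHeight u s x| ≤ s / 2 := by
  have h1 := Int.floor_le (⟪x, u⟫ / s)
  have h2 := Int.lt_floor_add_one (⟪x, u⟫ / s)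
  rw [le_div_iff₀ hs] at h1
  rw [div_lt_iff₀ hs] at h2
  rw [cellHeight, abs_le]
  constructor <;> linarith

theorem measurable_cellHeight (u : EuclideanSpace ℝ (Fin d)) (s : ℝ) :
    Measurable (cellHeight u s) := by
  unfold cellHeight
  have h : Measurable fun x : EuclideanSpace ℝ (Fin d) => ⟪x, u⟫ := by fun_prop
  have h2 : Measurable fun x : EuclideanSpace ℝ (Fin d) => ((⌊⟪x, u⟫ / s⌋ : ℤ) : ℝ) :=
    (measurable_of_countable (fun k : ℤ => (k : ℝ))).comp (Int.measurable_floor.comp (h.div_const s))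
  exact h.sub ((h2.add_const _).mul_const _)

theorem sub_cellHeight_smul_mem {u w : EuclideanSpace ℝ (Fin d)} (hw : ⟪w, u⟫ = 1) (s : ℝ)
    (x : EuclideanSpace ℝ (Fin d)) : x - cellHeight u s x • w ∈ hyperplaneFamily u s := by
  refine ⟨⌊⟪x, u⟫ / s⌋, ?_⟩
  rw [inner_sub_left, inner_smul_left, hw]
  simp [cellHeight]

theorem isClosed_hyperplaneFamily (u : EuclideanSpace ℝ (Fin d)) {s : ℝ} (hs : 0 < s) :
    IsClosed (hyperplaneFamily u s) := by
  have : hyperplaneFamily u s =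
      (fun x => ⟪x, u⟫ / s - 1 / 2) ⁻¹' (Set.range ((↑) : ℤ → ℝ)) := by
    ext x
    simp only [hyperplaneFamily, Set.mem_ofPred_eq, Set.mem_preimage, Set.mem_range]
    refine exists_congr fun k => ?_
    rw [eq_sub_iff_add_eq, eq_div_iff hs.ne']
    exact eq_comm
  rw [this]
  exact Int.isClosedEmbedding_coe_real.isClosed_range.preimage (by fun_prop)

theorem isOpen_slabFamily (u : EuclideanSpace ℝ (Fin d)) (s δ : ℝ) :
    IsOpen (slabFamily u s δ) := by
  have : slabFamily u s δ = ⋃ k : ℤ, {x | |⟪x, u⟫ - (k + 1 / 2) * s| < δ} := by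
    ext x; simp [slabFamily]
  rw [this]
  exact isOpen_iUnion fun k => isOpen_lt (by fun_prop) continuous_const

theorem lintegral_comp_floor_div {s : ℝ} (hs : 0 < s) (a : ℤ → ℝ≥0∞) :
    ∫⁻ t : ℝ, a ⌊t / s⌋ = ENNReal.ofReal s * ∑' k, a k := by
  have hm : Measurable fun t : ℝ => ⌊t / s⌋ := Int.measurable_floor.comp (measurable_id.div_const s)
  rw [← lintegral_map (f := a) (measurable_of_countable a) hm, lintegral_countable',
    ← ENNReal.tsum_mul_left]
  refine tsum_congr fun k => ?_
  rw [Measure.map_apply hm (measurableSet_singleton k), mul_comm]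
  congr 1
  have : (fun t : ℝ => ⌊t / s⌋) ⁻¹' {k} = Set.Ico (k * s) ((k + 1) * s) := by
    ext t
    simp [Int.floor_eq_iff, le_div_iff₀ hs, div_lt_iff₀ hs]
  rw [this, Real.volume_Ico]
  congr 1
  ring

/-- Sliding a subset of a family of hyperplanes along a transversal vector `w` sweeps out a set
whose volume is the product of the area and the spacing. -/
theorem volume_preimage_sub_cellHeight {u w : EuclideanSpace ℝ (Fin d)} (hu : ‖u‖ = 1)
    (hw : ⟪w, u⟫ = 1) {s : ℝ} (hs : 0 < s) {S : Set (EuclideanSpace ℝ (Fin d))}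
    (hS : MeasurableSet S) (hSF : S ⊆ hyperplaneFamily u s) :
    volume {x | x - cellHeight u s x • w ∈ S} = ENNReal.ofReal s * μHE[d - 1] S := by
  have hT : MeasurableSet {x | x - cellHeight u s x • w ∈ S} :=
    (measurable_id.sub ((measurable_cellHeight u s).smul_const w)) hS
  let H : ℤ → Set (EuclideanSpace ℝ (Fin d)) := fun k => {x | ⟪x, u⟫ = (k + 1 / 2) * s}
  have hH : ∀ k, MeasurableSet (H k) := fun k =>
    (isClosed_eq (by fun_prop) continuous_const).measurableSet
  -- Within one cell, every slice of the swept set is a translate, along $w$, of the part of $S$ on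
  -- that cell's hyperplane.
  have hslice : ∀ t : ℝ, μHE[d - 1] ({x | x - cellHeight u s x • w ∈ S} ∩ {x | ⟪x, u⟫ = t}) =
      μHE[d - 1] (S ∩ H ⌊t / s⌋) := by
    intro t
    rw [← euclideanHausdorffMeasure_image_add_right (d - 1)
      ((t - (⌊t / s⌋ + 1 / 2) * s) • w) (S ∩ H ⌊t / s⌋)]
    congr 1
    ext x
    simp only [Set.mem_inter_iff, Set.mem_ofPred_eq, Set.mem_image, H]
    constructor
    · rintro ⟨hx, rfl⟩
      refine ⟨_, ⟨hx, ?_⟩, by simp [cellHeight]⟩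
      rw [inner_sub_left, inner_smul_left, hw]
      simp [cellHeight]
    · rintro ⟨y, ⟨hy, hyu⟩, rfl⟩
      have ht : ⟪y + (t - (⌊t / s⌋ + 1 / 2) * s) • w, u⟫ = t := by
        rw [inner_add_left, inner_smul_left, hw, hyu]; simp
      refine ⟨?_, ht⟩
      simp only [cellHeight, ht]
      simpa using hy
  rw [volume_eq_lintegral_hyperplane hu hT]
  simp_rw [hslice]
  rw [lintegral_comp_floor_div hs (fun k => μHE[d - 1] (S ∩ H k))]
  congr 1
  rw [← measure_iUnion _ fun k => hS.inter (hH k), ← Set.inter_iUnion]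
  · congr 1
    refine Set.inter_eq_left.2 fun x hx => ?_
    obtain ⟨k, hk⟩ := hSF hx
    exact Set.mem_iUnion.2 ⟨k, hk⟩
  · intro j k hjk
    refine Set.disjoint_left.2 fun x hx hx' => hjk ?_
    have h : ((j : ℝ) + 1 / 2) * s = (k + 1 / 2) * s := hx.2.symm.trans hx'.2
    have := mul_right_cancel₀ hs.ne' h
    exact_mod_cast add_right_cancel this

/-- Sliding along the normal moves each point by at most $s/2$ onto the hyperplane of its cell, so
the ball is swept out by the part of the family in a slightly larger ball. -/
theorem volume_ball_le_hyperplaneFamily {u : EuclideanSpace ℝ (Fin d)} (hu : ‖u‖ = 1)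
    {s : ℝ} (hs : 0 < s) (x : EuclideanSpace ℝ (Fin d)) (r : ℝ) :
    volume (Metric.ball x r) ≤
      ENNReal.ofReal s * μHE[d - 1] (hyperplaneFamily u s ∩ Metric.ball x (r + s)) := by
  have hw : ⟪u, u⟫ = 1 := by simp [hu]
  rw [← volume_preimage_sub_cellHeight hu hw hs
    ((isClosed_hyperplaneFamily u hs).measurableSet.inter measurableSet_ball) Set.inter_subset_left]
  refine measure_mono fun y hy => ⟨sub_cellHeight_smul_mem hw s y, ?_⟩
  rw [Metric.mem_ball] at hy ⊢
  have h1 : dist (y - cellHeight u s y • u) y ≤ s / 2 := by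
    rw [dist_eq_norm]
    simpa [norm_smul, hu] using abs_cellHeight_le u hs y
  linarith [dist_triangle (y - cellHeight u s y • u) y x]

/-- A transversal $w$ along which $A$ is invariant sweeps the hyperplane pieces in $A$ through $A$
itself, turning an area bound into a volume bound. -/
theorem hyperplaneFamily_inter_le_volume {u w : EuclideanSpace ℝ (Fin d)} (hu : ‖u‖ = 1)
    (hw : ⟪w, u⟫ = 1) {s : ℝ} (hs : 0 < s) {A : Set (EuclideanSpace ℝ (Fin d))}
    (hA : MeasurableSet A) (hAw : ∀ (y : EuclideanSpace ℝ (Fin d)) (t : ℝ), y - t • w ∈ A → y ∈ A)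
    (x : EuclideanSpace ℝ (Fin d)) (r : ℝ) :
    ENNReal.ofReal s * μHE[d - 1] (hyperplaneFamily u s ∩ (A ∩ Metric.ball x r)) ≤
      volume (A ∩ Metric.ball x (r + s * ‖w‖)) := by
  rw [← volume_preimage_sub_cellHeight hu hw hs ((isClosed_hyperplaneFamily u hs).measurableSet.inter
    (hA.inter measurableSet_ball)) Set.inter_subset_left]
  refine measure_mono fun y hy => ⟨hAw _ _ hy.2.1, ?_⟩
  have hy2 := hy.2.2
  rw [Metric.mem_ball] at hy2 ⊢
  have h1 : dist y (y - cellHeight u s y • w) ≤ s / 2 * ‖w‖ := by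
    rw [dist_eq_norm]
    simp only [sub_sub_cancel, norm_smul, Real.norm_eq_abs]
    gcongr
    exact abs_cellHeight_le u hs y
  have h2 : 0 ≤ s / 2 * ‖w‖ := by positivity
  linarith [dist_triangle y (y - cellHeight u s y • w) x]

/-- Slabs of half-width `δ` occupy at most the fraction `1 / J` of space if `2 δ J ≤ s`. -/
theorem volume_slabFamily_inter_ball_le {u : EuclideanSpace ℝ (Fin d)} (hu : ‖u‖ = 1)
    {s δ : ℝ} (hs : 0 < s) {J : ℕ} (hJ : 2 * δ * J ≤ s)
    (x : EuclideanSpace ℝ (Fin d)) (r : ℝ) :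
    J * volume (slabFamily u s δ ∩ Metric.ball x r) ≤ volume (Metric.ball x (r + s)) := by
  by_cases hδ : 0 < δ
  swap
  · have : slabFamily u s δ = ∅ := by
      ext y
      simp only [slabFamily, Set.mem_ofPred_eq, Set.mem_empty_iff_false, iff_false, not_exists]
      intro k hk
      linarith [abs_nonneg (⟪y, u⟫ - (k + 1 / 2) * s)]
    simp [this]
  let A := slabFamily u s δ ∩ Metric.ball x r
  have hA : MeasurableSet A := (isOpen_slabFamily u s δ).measurableSet.inter measurableSet_ball
  -- $J$ copies of the slab part, shifted by multiples of the slab width $2\delta$, fit disjointly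
  -- into one period.
  let B : Fin J → Set (EuclideanSpace ℝ (Fin d)) := fun j => (fun y => y + (2 * δ * j) • u) '' A
  have hB : ∀ j, MeasurableSet (B j) := fun j =>
    (Homeomorph.addRight ((2 * δ * (j : ℝ)) • u)).toMeasurableEquiv.measurableSet_image.2 hA
  have hvol : ∀ j, volume (B j) = volume A := fun j => by
    simp [B]
  have hdisj : Pairwise (Function.onFun Disjoint B) := by
    have key : ∀ i j : Fin J, i < j → Disjoint (B i) (B j) := by
      intro i j hij
      refine Set.disjoint_left.2 ?_
      rintro _ ⟨y, ⟨⟨k, hk⟩, -⟩, rfl⟩ ⟨z, ⟨⟨l, hl⟩, -⟩, hz⟩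
      have hz' := congrArg (fun v => ⟪v, u⟫) hz
      simp only [inner_add_left, inner_smul_left, real_inner_self_eq_norm_sq, hu] at hz'
      simp only [conj_trivial, one_pow, mul_one] at hz'
      rw [abs_lt] at hk hl
      have h1 : (i : ℝ) + 1 ≤ (j : ℝ) := by exact_mod_cast hij
      have h2 : (j : ℝ) + 1 ≤ J := by exact_mod_cast j.2
      have h3 : (0 : ℝ) ≤ i := by positivity
      have e1 : 2 * δ * ((i : ℝ) + 1) ≤ 2 * δ * j := by gcongr
      have e2 : 2 * δ * ((j : ℝ) + 1) ≤ 2 * δ * J := by gcongr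
      have e3 : 0 ≤ 2 * δ * (i : ℝ) := by positivity
      -- A common point would make $(k-l)s$ differ from $2\delta(j-i)$ by less than $2\delta$, hence
      -- lie strictly between $0$ and $s$, impossible for integers $k,l$.
      have e4 : 0 < ((k : ℝ) - l) * s := by nlinarith
      have e5 : ((k : ℝ) - l) * s < 1 * s := by nlinarith
      have e6 : (k : ℝ) - l < 1 := lt_of_mul_lt_mul_right e5 hs.le
      have e7 : (0 : ℝ) < (k : ℝ) - l := pos_of_mul_pos_left e4 hs.le
      have e8 : (k - l : ℤ) < 1 := by exact_mod_cast e6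
      have e9 : (0 : ℤ) < k - l := by exact_mod_cast e7
      omega
    intro i j hij
    rcases lt_or_gt_of_ne hij with h | h
    · exact key i j h
    · exact (key j i h).symm
  calc (J : ℝ≥0∞) * volume A = ∑ j : Fin J, volume (B j) := by simp [hvol]
    _ = volume (⋃ j, B j) := by
      rw [measure_iUnion hdisj hB, tsum_fintype]
    _ ≤ _ := by
      refine measure_mono (Set.iUnion_subset fun j => ?_)
      rintro _ ⟨y, ⟨-, hy⟩, rfl⟩
      rw [Metric.mem_ball] at hy ⊢
      have h2 : (j : ℝ) ≤ J := by exact_mod_cast j.2.le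
      have h1 : dist (y + (2 * δ * (j : ℝ)) • u) y ≤ s := by
        rw [dist_eq_norm, add_sub_cancel_left, norm_smul, hu, mul_one, Real.norm_eq_abs,
          abs_of_nonneg (by positivity)]
        exact le_trans (by gcongr) hJ
      linarith [dist_triangle (y + (2 * δ * (j : ℝ)) • u) y x]

end HyperplaneFamilies

/-! ### Regularity and density of the grid with its crossings removed. -/

section ThinnedGrid

variable {d : ℕ} {ι : Type*}

/-- The `i`-th family of hyperplanes without the `δ`-slabs about the other families. -/
def thinnedFamily (u : ι → EuclideanSpace ℝ (Fin d)) (s : ι → ℝ) (δ : ℝ) (i : ι) :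
    Set (EuclideanSpace ℝ (Fin d)) :=
  hyperplaneFamily (u i) (s i) \ ⋃ (j) (_ : j ≠ i), slabFamily (u j) (s j) δ

/-- A union of families of hyperplanes with neighbourhoods of the mutual intersections removed. -/
def thinnedGrid (u : ι → EuclideanSpace ℝ (Fin d)) (s : ι → ℝ) (δ : ℝ) :
    Set (EuclideanSpace ℝ (Fin d)) :=
  ⋃ i, thinnedFamily u s δ i

/-- Take the component of $u$ orthogonal to $v$, rescaled. Sliding along it crosses the family
normal to $u$ but preserves the slabs normal to $v$. -/
theorem exists_inner_eq_one_inner_eq_zero {u v : EuclideanSpace ℝ (Fin d)} (hu : ‖u‖ = 1)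
    (hv : ‖v‖ = 1) (h1 : u ≠ v) (h2 : u ≠ -v) :
    ∃ w : EuclideanSpace ℝ (Fin d), ⟪w, u⟫ = 1 ∧ ⟪w, v⟫ = 0 := by
  have hc1 : ⟪u, v⟫ < 1 := inner_lt_one_iff_real_of_norm_eq_one hu hv |>.2 h1
  have hc2 : ⟪u, -v⟫ < 1 := inner_lt_one_iff_real_of_norm_eq_one hu (by simpa using hv) |>.2 h2
  rw [inner_neg_right] at hc2
  have hc : 1 - ⟪u, v⟫ ^ 2 ≠ 0 := by nlinarith
  refine ⟨(1 - ⟪u, v⟫ ^ 2)⁻¹ • (u - ⟪u, v⟫ • v), ?_, ?_⟩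
  · rw [inner_smul_left, inner_sub_left, inner_smul_left, real_inner_self_eq_norm_sq, hu,
      real_inner_comm u v]
    simp only [conj_trivial]
    field_simp
  · rw [inner_smul_left, inner_sub_left, inner_smul_left, real_inner_self_eq_norm_sq, hv]
    simp

variable {u : ι → EuclideanSpace ℝ (Fin d)} {s : ι → ℝ} {δ : ℝ}

theorem hyperplaneFamily_subset_slabFamily (hδ : 0 < δ) (i : ι) :
    hyperplaneFamily (u i) (s i) ⊆ slabFamily (u i) (s i) δ := by
  rintro x ⟨k, hk⟩
  exact ⟨k, by simpa [hk] using hδ⟩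

theorem isClosed_thinnedFamily (hs : ∀ i, 0 < s i) (i : ι) :
    IsClosed (thinnedFamily u s δ i) :=
  (isClosed_hyperplaneFamily (u i) (hs i)).sdiff
    (isOpen_biUnion fun j _ => isOpen_slabFamily (u j) (s j) δ)

theorem isClosed_thinnedGrid [Finite ι] (hs : ∀ i, 0 < s i) : IsClosed (thinnedGrid u s δ) :=
  isClosed_iUnion_of_finite fun i => isClosed_thinnedFamily hs i

theorem thinnedFamily_disjoint (hδ : 0 < δ) :
    Pairwise (Function.onFun Disjoint (thinnedFamily u s δ)) := by
  intro i j hij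
  refine Set.disjoint_left.2 fun x hx hx' => hx'.2 ?_
  exact Set.mem_biUnion (by exact hij) (hyperplaneFamily_subset_slabFamily hδ i hx.1)

/-- Near each point, at scales below `δ / 2`, a thinned grid is part of one hyperplane. -/
theorem thinnedGrid_inter_ball_subset (hu : ∀ i, ‖u i‖ = 1) (hs : ∀ i, 2 * δ ≤ s i) (hδ : 0 < δ)
    {r : ℝ} (hr : 2 * r ≤ δ) {x z : EuclideanSpace ℝ (Fin d)}
    (hz : z ∈ thinnedGrid u s δ ∩ Metric.ball x r) :
    ∃ i t, thinnedGrid u s δ ∩ Metric.ball x r ⊆ {y | ⟪y, u i⟫ = t} ∩ Metric.ball x r := by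
  obtain ⟨hzΓ, hzr⟩ := hz
  obtain ⟨i, hzi⟩ := Set.mem_iUnion.1 hzΓ
  obtain ⟨k, hk⟩ := hzi.1
  refine ⟨i, (k + 1 / 2) * s i, fun y hy => ⟨?_, hy.2⟩⟩
  obtain ⟨j, hyj⟩ := Set.mem_iUnion.1 hy.1
  obtain ⟨l, hl⟩ := hyj.1
  have hd : ‖z - y‖ < δ := by
    have h1 := Metric.mem_ball.1 hzr
    have h2 := Metric.mem_ball'.1 hy.2
    rw [← dist_eq_norm]
    linarith [dist_triangle z x y]
  have hin : |⟪z, u j⟫ - ⟪y, u j⟫| < δ := by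
    rw [← inner_sub_left]
    refine lt_of_le_of_lt (abs_real_inner_le_norm _ _) ?_
    rwa [hu j, mul_one]
  by_cases hij : j = i
  · subst hij
    rw [hk, hl, ← sub_mul, abs_mul] at hin
    have hsj : 0 < s j := by linarith [hs j]
    rw [abs_of_pos hsj] at hin
    have h3 : |((k : ℝ) + 1 / 2 - (l + 1 / 2))| * s j < 1 * s j := by linarith [hs j]
    have h4 := lt_of_mul_lt_mul_right h3 hsj.le
    have h5 : |((k - l : ℤ) : ℝ)| < 1 := by
      push_cast; simpa using h4
    have h6 : |k - l| < 1 := by exact_mod_cast h5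
    have : k = l := by
      rw [Int.abs_lt_one_iff] at h6; omega
    subst this
    exact hl
  -- A point of another family this close would put $z$ inside a slab that was deleted from the
  -- family of $z$.
  · have hzj : z ∈ slabFamily (u j) (s j) δ := ⟨l, by rwa [← hl]⟩
    exact absurd (Set.mem_iUnion₂.2 ⟨j, hij, hzj⟩) hzi.2

theorem volume_ball_eq_mul (hd : d ≠ 0) (x : EuclideanSpace ℝ (Fin d)) {r : ℝ} (hr : 0 ≤ r) :
    volume (Metric.ball x r) =
      ENNReal.ofReal (r ^ d * (volume (Metric.ball (0 : EuclideanSpace ℝ (Fin d)) 1)).toReal) := by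
  have : Nonempty (Fin d) := ⟨⟨0, Nat.pos_of_ne_zero hd⟩⟩
  rw [ENNReal.ofReal_mul (by positivity), ENNReal.ofReal_toReal measure_ball_lt_top.ne]
  simpa using Measure.addHaar_ball volume x hr

theorem thinnedGrid_isPhiRegular [Fintype ι] (hu : ∀ i, ‖u i‖ = 1) (hs : ∀ i, 2 * δ ≤ s i)
    (hδ : 0 < δ) :
    ∃ φ : ℝ≥0 → ℝ≥0, Continuous φ ∧ φ 0 = 1 ∧ IsPhiRegular φ (thinnedGrid u s δ) := by
  have hs0 : ∀ i, 0 < s i := fun i => by linarith [hs i]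
  let C : ℝ≥0∞ := ∑ i, (ENNReal.ofReal (s i))⁻¹ *
    volume (Metric.ball (0 : EuclideanSpace ℝ (Fin d)) (1 + s i * ‖u i‖))
  have hC : C ≠ ∞ := ENNReal.sum_ne_top.2 fun i _ =>
    ENNReal.mul_ne_top (by simpa using hs0 i) measure_ball_lt_top.ne
  have hbound : ∀ x, μHE[d - 1] (thinnedGrid u s δ ∩ Metric.ball x 1) ≤ C := by
    intro x
    rw [thinnedGrid, Set.iUnion_inter]
    refine (measure_iUnion_le _).trans ?_
    rw [tsum_fintype]
    refine Finset.sum_le_sum fun i _ => ?_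
    have h := hyperplaneFamily_inter_le_volume (hu i) (w := u i) (by simp [hu i]) (hs0 i)
      MeasurableSet.univ (fun _ _ _ => trivial) x 1
    rw [Set.univ_inter, Set.univ_inter, Measure.addHaar_ball_center] at h
    calc _ ≤ μHE[d - 1] (hyperplaneFamily (u i) (s i) ∩ Metric.ball x 1) :=
          measure_mono (Set.inter_subset_inter_left _ Set.sdiff_subset)
      _ ≤ _ := by
        rw [mul_comm, ← div_eq_mul_inv, ENNReal.le_div_iff_mul_le
          (Or.inl (by simpa using hs0 i)) (Or.inl ENNReal.ofReal_ne_top), mul_comm]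
        exact h
  let δ' : ℝ≥0 := ⟨δ / 2, by positivity⟩
  have hδ' : (δ' : ℝ≥0∞) ≠ 0 := by
    have h : 0 < δ' := half_pos hδ
    exact_mod_cast h.ne'
  -- $C$ bounds the area in any unit ball. $D$ is chosen so that the term $Dr$ in $\varphi(r)=1+Dr$
  -- alone absorbs $C$ for $r\ge\delta/2$; below that scale the grid meets the ball in one
  -- hyperplane and the term 1 suffices.
  let D : ℝ≥0∞ := C / (δ' * unitBallVolume (d - 1) * (δ' : ℝ≥0∞) ^ (d - 1))
  have hden : δ' * unitBallVolume (d - 1) * (δ' : ℝ≥0∞) ^ (d - 1) ≠ 0 :=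
    mul_ne_zero (mul_ne_zero hδ' (unitBallVolume_ne_zero _)) (pow_ne_zero _ hδ')
  have hden' : δ' * unitBallVolume (d - 1) * (δ' : ℝ≥0∞) ^ (d - 1) ≠ ∞ :=
    ENNReal.mul_ne_top (ENNReal.mul_ne_top ENNReal.coe_ne_top (unitBallVolume_ne_top _))
      (ENNReal.pow_ne_top ENNReal.coe_ne_top)
  have hD : D ≠ ∞ := ENNReal.div_ne_top hC hden
  refine ⟨fun r => 1 + D.toNNReal * r, by fun_prop, by simp, isClosed_thinnedGrid hs0, ?_⟩
  intro x r hr0 hr1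
  by_cases hr : 2 * (r : ℝ) ≤ δ
  · rcases (thinnedGrid u s δ ∩ Metric.ball x (r : ℝ)).eq_empty_or_nonempty with h | ⟨z, hz⟩
    · simp [h]
    · obtain ⟨i, t, hit⟩ := thinnedGrid_inter_ball_subset hu hs hδ hr hz
      refine (measure_mono hit).trans
        ((euclideanHausdorffMeasure_ball_inter_hyperplane_le (hu i) t x hr0).trans ?_)
      gcongr
      refine le_mul_of_one_le_left zero_le ?_
      push_cast
      exact le_self_add
  · push Not at hr
    have hδr : δ' ≤ r := by
      rw [← NNReal.coe_le_coe]; change δ / 2 ≤ r; linarith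
    have hCD : C = D * (δ' * unitBallVolume (d - 1) * (δ' : ℝ≥0∞) ^ (d - 1)) :=
      (ENNReal.div_mul_cancel hden hden').symm
    calc _ ≤ μHE[d - 1] (thinnedGrid u s δ ∩ Metric.ball x 1) := by
          refine measure_mono (Set.inter_subset_inter_right _ (Metric.ball_subset_ball ?_))
          exact_mod_cast hr1.le
      _ ≤ C := hbound x
      _ = D * (δ' * unitBallVolume (d - 1) * (δ' : ℝ≥0∞) ^ (d - 1)) := hCD
      _ ≤ D * (r * unitBallVolume (d - 1) * (r : ℝ≥0∞) ^ (d - 1)) := by gcongr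
      _ = (D * r) * unitBallVolume (d - 1) * (r : ℝ≥0∞) ^ (d - 1) := by ring
      _ ≤ _ := by
        gcongr
        push_cast
        rw [ENNReal.coe_toNNReal hD]
        exact le_add_self

/-- A lower bound for the area of one family of a thinned grid in a ball. -/
theorem le_thinnedFamily_inter_ball [Fintype ι] (hu : ∀ i, ‖u i‖ = 1)
    (hne : ∀ i j, i ≠ j → u i ≠ u j ∧ u i ≠ -u j) (hs : ∀ i, 0 < s i) :
    ∃ C : ℝ, 0 < C ∧ ∀ (J : ℕ) (δ : ℝ), (∀ i, 2 * δ * J ≤ s i) →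
      ∀ (i : ι) (x : EuclideanSpace ℝ (Fin d)) (r : ℝ),
        J * volume (Metric.ball x (r - C)) ≤
          J * (ENNReal.ofReal (s i) * μHE[d - 1] (thinnedFamily u s δ i ∩ Metric.ball x r)) +
            Fintype.card ι * volume (Metric.ball x (r + C)) := by
  classical
  have hw : ∀ i j, ∃ w : EuclideanSpace ℝ (Fin d), i ≠ j → ⟪w, u i⟫ = 1 ∧ ⟪w, u j⟫ = 0 := by
    intro i j
    by_cases hij : i = j
    · exact ⟨0, fun h => absurd hij h⟩
    · obtain ⟨w, hw⟩ := exists_inner_eq_one_inner_eq_zero (hu i) (hu j) (hne i j hij).1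
        (hne i j hij).2
      exact ⟨w, fun _ => hw⟩
  choose w hw using hw
  -- One constant dominating every enlargement of radius caused by sliding a family or shifting
  -- slabs.
  let C : ℝ := 1 + ∑ i, ∑ j, (s i * ‖w i j‖ + s j + s i)
  have hterm : ∀ i j, 0 ≤ s i * ‖w i j‖ + s j + s i := fun i j => by
    have := (hs i).le; have := (hs j).le; positivity
  have hCij : ∀ i j, s i * ‖w i j‖ + s j + s i ≤ C := fun i j => by
    have h1 := Finset.single_le_sum (f := fun j => s i * ‖w i j‖ + s j + s i)
      (fun j _ => hterm i j) (Finset.mem_univ j)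
    have h2 := Finset.single_le_sum (f := fun i => ∑ j, (s i * ‖w i j‖ + s j + s i))
      (fun i _ => Finset.sum_nonneg fun j _ => hterm i j) (Finset.mem_univ i)
    simp only [C]
    linarith
  refine ⟨C, ?_, fun J δ hJ i x r => ?_⟩
  · have : 0 ≤ ∑ i, ∑ j, (s i * ‖w i j‖ + s j + s i) :=
      Finset.sum_nonneg fun i _ => Finset.sum_nonneg fun j _ => hterm i j
    simp only [C]; linarith
  have hsC : s i ≤ C := by
    have := hCij i i
    have h1 := (hs i).le
    have : 0 ≤ s i * ‖w i i‖ := by positivity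
    linarith
  have h1 : volume (Metric.ball x (r - C)) ≤
      ENNReal.ofReal (s i) * μHE[d - 1] (hyperplaneFamily (u i) (s i) ∩ Metric.ball x r) := by
    refine (volume_ball_le_hyperplaneFamily (hu i) (hs i) x (r - C)).trans ?_
    gcongr
    linarith
  have h2 : ∀ j, j ≠ i → J * (ENNReal.ofReal (s i) * μHE[d - 1]
      (hyperplaneFamily (u i) (s i) ∩ (slabFamily (u j) (s j) δ ∩ Metric.ball x r))) ≤
        volume (Metric.ball x (r + C)) := by
    intro j hj
    have hwij := hw i j hj.symm
    have hA := hyperplaneFamily_inter_le_volume (hu i) hwij.1 (hs i)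
      (isOpen_slabFamily (u j) (s j) δ).measurableSet (fun y t hy => by
        obtain ⟨k, hk⟩ := hy
        refine ⟨k, ?_⟩
        rwa [inner_sub_left, inner_smul_left, hwij.2, mul_zero, sub_zero] at hk) x r
    refine (mul_le_mul_right hA _).trans
      ((volume_slabFamily_inter_ball_le (hu j) (hs j) (hJ j) x _).trans (measure_mono ?_))
    refine Metric.ball_subset_ball ?_
    linarith [hCij i j, (hs i).le]
  have h3 : μHE[d - 1] (hyperplaneFamily (u i) (s i) ∩ Metric.ball x r) ≤
      μHE[d - 1] (thinnedFamily u s δ i ∩ Metric.ball x r) +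
      ∑ j ∈ Finset.univ.erase i, μHE[d - 1]
        (hyperplaneFamily (u i) (s i) ∩ (slabFamily (u j) (s j) δ ∩ Metric.ball x r)) := by
    refine (measure_mono ?_).trans ((measure_union_le _ _).trans
      (add_le_add_right (measure_biUnion_finset_le _ _) _))
    rintro y ⟨hy, hyr⟩
    by_cases h : y ∈ ⋃ (j) (_ : j ≠ i), slabFamily (u j) (s j) δ
    · right
      simp only [Set.mem_iUnion] at h ⊢
      obtain ⟨j, hj, hyj⟩ := h
      exact ⟨j, by simpa using hj, hy, hyj, hyr⟩
    · exact Or.inl ⟨⟨hy, h⟩, hyr⟩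
  calc J * volume (Metric.ball x (r - C))
      ≤ J * (ENNReal.ofReal (s i) * (μHE[d - 1] (thinnedFamily u s δ i ∩ Metric.ball x r) +
      ∑ j ∈ Finset.univ.erase i, μHE[d - 1]
        (hyperplaneFamily (u i) (s i) ∩ (slabFamily (u j) (s j) δ ∩ Metric.ball x r)))) := by
        gcongr
        exact h1.trans (by gcongr)
    _ = J * (ENNReal.ofReal (s i) * μHE[d - 1] (thinnedFamily u s δ i ∩ Metric.ball x r)) +
      ∑ j ∈ Finset.univ.erase i, J * (ENNReal.ofReal (s i) * μHE[d - 1]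
        (hyperplaneFamily (u i) (s i) ∩ (slabFamily (u j) (s j) δ ∩ Metric.ball x r))) := by
        rw [mul_add, mul_add, Finset.mul_sum, Finset.mul_sum]
    _ ≤ _ := by
        gcongr
        refine (Finset.sum_le_card_nsmul _ _ _ fun j hj => h2 j (Finset.ne_of_mem_erase hj)).trans ?_
        rw [nsmul_eq_mul]
        gcongr
        exact Finset.card_le_univ _

theorem exists_thinnedGrid_density [Fintype ι] (hd : d ≠ 0) (hu : ∀ i, ‖u i‖ = 1)
    (hne : ∀ i j, i ≠ j → u i ≠ u j ∧ u i ≠ -u j) (hs : ∀ i, 0 < s i)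
    {c : ℝ} (hc : 0 < c) (hcs : c < ∑ i, (s i)⁻¹) :
    ∃ δ : ℝ, 0 < δ ∧ (∀ i, 2 * δ ≤ s i) ∧
      ENNReal.ofReal c ≤ lowerSurfaceDensity (thinnedGrid u s δ) := by
  obtain ⟨C, hC0, hC⟩ := le_thinnedFamily_inter_ball hu hne hs
  set n : ℝ := (Fintype.card ι : ℝ) with hn
  set S : ℝ := ∑ i, (s i)⁻¹ with hS
  -- Slabs of relative width $1/J$ about at most $n$ families cost a fraction at most $n/J$ of the
  -- density.
  obtain ⟨J, hJ0, hJ⟩ : ∃ J : ℕ, 0 < J ∧ c < (1 - n / J) * S := by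
    have h1 : Tendsto (fun J : ℕ => (1 - n / (J : ℝ)) * S) atTop (𝓝 ((1 - 0) * S)) :=
      ((tendsto_const_div_atTop_nhds_zero_nat n).const_sub 1).mul_const S
    rw [sub_zero, one_mul] at h1
    obtain ⟨J, hJ1, hJ2⟩ := ((h1.eventually (lt_mem_nhds hcs)).and (eventually_gt_atTop 0)).exists
    exact ⟨J, hJ2, hJ1⟩
  obtain ⟨m, hm0, hm⟩ : ∃ m : ℝ, 0 < m ∧ ∀ i, m ≤ s i := by
    rcases isEmpty_or_nonempty ι with h | h
    · exact ⟨1, one_pos, fun i => h.elim i⟩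
    · obtain ⟨i, hi⟩ := Finite.exists_min s
      exact ⟨s i, hs i, hi⟩
  have hJ0' : (0 : ℝ) < J := by exact_mod_cast hJ0
  have hJ1 : (1 : ℝ) ≤ J := by exact_mod_cast hJ0
  refine ⟨m / (2 * J), by positivity, fun i => ?_, ?_⟩
  · refine le_trans ?_ (hm i)
    have : 2 * (m / (2 * J)) = m / J := by field_simp
    rw [this]
    exact div_le_self hm0.le hJ1
  have hδ : ∀ i, 2 * (m / (2 * J)) * J ≤ s i := fun i => by
    have : 2 * (m / (2 * J)) * J = m := by field_simp
    rw [this]; exact hm i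
  set δ := m / (2 * J) with hδd
  have hδ0 : 0 < δ := by positivity
  -- A lower bound for spacing times area over ball volume, for each thinned family; it tends to
  -- $1-n/J$ because the radius changes $\pm C$ become negligible.
  let q : ℝ → ℝ := fun r => (1 - C / r) ^ d - n / J * (1 + C / r) ^ d
  have hq : Tendsto (fun r => q r * S) atTop (𝓝 (((1 - 0) ^ d - n / J * (1 + 0) ^ d) * S)) := by
    have h0 : Tendsto (fun r : ℝ => C / r) atTop (𝓝 0) := tendsto_const_nhds.div_atTop tendsto_id
    exact (((h0.const_sub 1).pow d).sub (((h0.const_add 1).pow d).const_mul _)).mul_const S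
  simp only [sub_zero, add_zero, one_pow, mul_one] at hq
  refine le_liminf_of_le (by isBoundedDefault) ?_
  filter_upwards [hq.eventually (lt_mem_nhds hJ), eventually_gt_atTop C] with r hr1 hr2
  have hr0 : 0 < r := hC0.trans hr2
  refine le_iInf fun x => ?_
  have hS0 : 0 < S := hc.trans hcs
  have hq0 : 0 < q r := pos_of_mul_pos_left (hc.trans hr1) hS0.le
  have hV0 : 0 < (volume (Metric.ball (0 : EuclideanSpace ℝ (Fin d)) 1)).toReal :=
    ENNReal.toReal_pos (Metric.measure_ball_pos _ _ one_pos).ne' measure_ball_lt_top.ne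
  rw [ENNReal.le_div_iff_mul_le (Or.inl (Metric.measure_ball_pos _ _ hr0).ne')
    (Or.inl measure_ball_lt_top.ne)]
  have hpiece : ∀ i, ENNReal.ofReal (q r * (s i)⁻¹) * volume (Metric.ball x r) ≤
      μHE[d - 1] (thinnedFamily u s δ i ∩ Metric.ball x r) := by
    intro i
    have h := hC J δ hδ i x r
    rw [volume_ball_eq_mul hd x (by linarith : 0 ≤ r - C),
      volume_ball_eq_mul hd x (by linarith : 0 ≤ r + C)] at h
    rw [volume_ball_eq_mul hd x hr0.le]
    set V := (volume (Metric.ball (0 : EuclideanSpace ℝ (Fin d)) 1)).toReal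
    generalize μHE[d - 1] (thinnedFamily u s δ i ∩ Metric.ball x r) = M at h ⊢
    by_cases hM : M = ∞
    · simp [hM]
    have hsi := hs i
    have hM' : M = ENNReal.ofReal M.toReal := (ENNReal.ofReal_toReal hM).symm
    have hMnn : 0 ≤ M.toReal := ENNReal.toReal_nonneg
    have hJe : (J : ℝ≥0∞) = ENNReal.ofReal J := by simp
    have hne : (Fintype.card ι : ℝ≥0∞) = ENNReal.ofReal n := by simp [hn]
    have hn0 : 0 ≤ n := by positivity
    have hrC : 0 ≤ r - C := by linarith
    rw [hM', hJe, hne, ← ENNReal.ofReal_mul hsi.le, ← ENNReal.ofReal_mul hJ0'.le,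
      ← ENNReal.ofReal_mul hJ0'.le, ← ENNReal.ofReal_mul hn0,
      ← ENNReal.ofReal_add (by positivity) (by positivity),
      ENNReal.ofReal_le_ofReal_iff (by positivity)] at h
    rw [hM', ← ENNReal.ofReal_mul (by positivity)]
    refine ENNReal.ofReal_le_ofReal ?_
    have e1 : (1 - C / r) ^ d * r ^ d = (r - C) ^ d := by
      rw [← mul_pow]; congr 1; field_simp
    have e2 : (1 + C / r) ^ d * r ^ d = (r + C) ^ d := by
      rw [← mul_pow]; congr 1; field_simp
    have e3 : q r * (s i)⁻¹ * (r ^ d * V) =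
        (J * s i)⁻¹ * (J * ((r - C) ^ d * V) - n * ((r + C) ^ d * V)) := by
      simp only [q]
      rw [← e1, ← e2]
      field_simp
    rw [e3, inv_mul_le_iff₀ (by positivity)]
    linarith
  calc ENNReal.ofReal c * volume (Metric.ball x r)
      ≤ ENNReal.ofReal (q r * S) * volume (Metric.ball x r) := by gcongr
    _ = ∑ i, ENNReal.ofReal (q r * (s i)⁻¹) * volume (Metric.ball x r) := by
      rw [hS, Finset.mul_sum, ENNReal.ofReal_sum_of_nonneg, Finset.sum_mul]
      intro i _
      have := hs i
      positivity
    _ ≤ ∑ i, μHE[d - 1] (thinnedFamily u s δ i ∩ Metric.ball x r) :=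
      Finset.sum_le_sum fun i _ => hpiece i
    _ = μHE[d - 1] (thinnedGrid u s δ ∩ Metric.ball x r) := by
      rw [thinnedGrid, Set.iUnion_inter, measure_iUnion, tsum_fintype]
      · intro i j hij
        exact (thinnedFamily_disjoint hδ0 hij).mono Set.inter_subset_left Set.inter_subset_left
      · exact fun i => (isClosed_thinnedFamily hs i).measurableSet.inter measurableSet_ball

end ThinnedGrid

/-! ### Products of cosines, their spectrum, and the polar body. -/

section PaleyWiener

variable {d N : ℕ}

/-- A product of cosines, as a complex-valued function. -/
noncomputable def cosProd (ξ : Fin N → EuclideanSpace ℝ (Fin d))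
    (x : EuclideanSpace ℝ (Fin d)) : ℂ :=
  ((∏ n, Real.cos (2 * Real.pi * ⟪x, ξ n⟫) : ℝ) : ℂ)

theorem continuous_cosProd (ξ : Fin N → EuclideanSpace ℝ (Fin d)) : Continuous (cosProd ξ) := by
  unfold cosProd
  fun_prop

theorem norm_cosProd_le_one (ξ : Fin N → EuclideanSpace ℝ (Fin d))
    (x : EuclideanSpace ℝ (Fin d)) : ‖cosProd ξ x‖ ≤ 1 := by
  rw [cosProd, Complex.norm_real, Real.norm_eq_abs, Finset.abs_prod]
  exact Finset.prod_le_one (fun _ _ => abs_nonneg _) fun _ _ => Real.abs_cos_le_one _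

@[simp]
theorem cosProd_zero (ξ : Fin N → EuclideanSpace ℝ (Fin d)) : cosProd ξ 0 = 1 := by
  simp [cosProd]

theorem memLp_top_cosProd (ξ : Fin N → EuclideanSpace ℝ (Fin d)) : MemLp (cosProd ξ) ∞ volume :=
  memLp_top_of_bound (continuous_cosProd ξ).aestronglyMeasurable 1
    (Eventually.of_forall (norm_cosProd_le_one ξ))

theorem eLpNorm_top_cosProd (ξ : Fin N → EuclideanSpace ℝ (Fin d)) :
    eLpNorm (cosProd ξ) ∞ volume = 1 := by
  refine le_antisymm ?_ ?_
  · rw [eLpNorm_exponent_top]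
    refine (eLpNormEssSup_le_of_ae_bound (C := 1)
      (Eventually.of_forall (norm_cosProd_le_one ξ))).trans (by simp)
  · rw [eLpNorm_exponent_top]
    -- The almost everywhere bound by the essential supremum holds on a dense set, hence by
    -- continuity at $0$, where the function equals 1.
    have hd := Measure.dense_of_ae (enorm_ae_le_eLpNormEssSup (cosProd ξ) volume)
    have hc : IsClosed {x | ‖cosProd ξ x‖ₑ ≤ eLpNormEssSup (cosProd ξ) volume} :=
      isClosed_le (continuous_cosProd ξ).enorm continuous_const
    have h0 := hc.closure_eq ▸ hd 0
    simpa using h0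

theorem cosProd_eq_sum_exp (ξ : Fin N → EuclideanSpace ℝ (Fin d))
    (x : EuclideanSpace ℝ (Fin d)) :
    cosProd ξ x = ∑ t : Finset (Fin N), (2⁻¹ : ℂ) ^ N *
      Complex.exp (2 * Real.pi * ⟪x, ∑ n ∈ t, ξ n - ∑ n ∈ tᶜ, ξ n⟫ * Complex.I) := by
  rw [cosProd, Complex.ofReal_prod]
  have h : ∀ n, ((Real.cos (2 * Real.pi * ⟪x, ξ n⟫) : ℝ) : ℂ) =
      2⁻¹ * (Complex.exp (2 * Real.pi * ⟪x, ξ n⟫ * Complex.I) +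
        Complex.exp (-(2 * Real.pi * ⟪x, ξ n⟫ * Complex.I))) := by
    intro n
    rw [Complex.ofReal_cos, Complex.cos]
    push_cast
    ring_nf
  simp_rw [h]
  rw [Finset.prod_mul_distrib, Finset.prod_const, Finset.card_univ, Fintype.card_fin,
    Finset.prod_add, Finset.powerset_univ, Finset.mul_sum]
  refine Finset.sum_congr rfl fun t _ => ?_
  rw [← Complex.exp_sum, ← Complex.exp_sum, ← Complex.exp_add, ← Finset.compl_eq_univ_sdiff]
  congr 2
  rw [inner_sub_right, inner_sum, inner_sum, Finset.sum_neg_distrib, ← Finset.sum_mul,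
    ← Finset.sum_mul, ← Finset.mul_sum, ← Finset.mul_sum]
  push_cast
  ring

theorem cosProd_mem_paleyWienerInfty {K : Set (EuclideanSpace ℝ (Fin d))} (hK : IsClosed K)
    {ξ : Fin N → EuclideanSpace ℝ (Fin d)}
    (hξ : ∀ t : Finset (Fin N), ∑ n ∈ t, ξ n - ∑ n ∈ tᶜ, ξ n ∈ K) :
    cosProd ξ ∈ paleyWienerInfty K := by
  refine ⟨continuous_cosProd ξ, memLp_top_cosProd ξ, fun x hx => ?_⟩
  -- It is enough that the distribution kills every test function supported off the closed set $K$.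
  refine (Distribution.mem_dsupport_iff x).1 hx K (fun g hg => ?_) hK
  rw [TemperedDistribution.fourierInv_apply, Lp.toTemperedDistribution_apply]
  obtain ⟨G, hG⟩ : ∃ G : 𝓢(EuclideanSpace ℝ (Fin d), ℂ), G = 𝓕⁻ g := ⟨_, rfl⟩
  rw [← hG]
  have h1 : ∀ᵐ y, G y • ((memLp_top_cosProd ξ).toLp (cosProd ξ)) y = ∑ t : Finset (Fin N),
      (2⁻¹ : ℂ) ^ N * (Complex.exp (2 * Real.pi * ⟪y, ∑ n ∈ t, ξ n - ∑ n ∈ tᶜ, ξ n⟫ * Complex.I)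
        * G y) := by
    filter_upwards [(memLp_top_cosProd ξ).coeFn_toLp] with y hy
    rw [hy, cosProd_eq_sum_exp, smul_eq_mul, Finset.mul_sum]
    exact Finset.sum_congr rfl fun t _ => by ring
  rw [integral_congr_ae h1, integral_finsetSum]
  · refine Finset.sum_eq_zero fun t _ => ?_
    rw [integral_const_mul]
    set η := ∑ n ∈ t, ξ n - ∑ n ∈ tᶜ, ξ n with hη
    have h2 : ∫ y, Complex.exp (2 * Real.pi * ⟪y, η⟫ * Complex.I) * G y = (𝓕⁻ G) η := by
      rw [SchwartzMap.fourierInv_coe, Real.fourierInv_eq']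
      simp [smul_eq_mul]
    -- Two inverse transforms compose to a reflection, so each exponential evaluates the test
    -- function at $-\eta$, the signed sum for the complementary choice of signs.
    have h3 : (𝓕⁻ G) η = g (-η) := by
      rw [SchwartzMap.fourierInv_coe, Real.fourierInv_eq_fourier_neg, ← SchwartzMap.fourier_coe, hG]
      simp
    have h4 : -η ∈ K := by
      have := hξ tᶜ
      rw [compl_compl] at this
      rwa [hη, neg_sub]
    rw [h2, h3, image_eq_zero_of_notMem_tsupport fun h => hg h h4, mul_zero]
  · intro t _
    refine Integrable.const_mul ?_ _
    refine G.integrable.bdd_mul (c := 1) (Continuous.aestronglyMeasurable (by fun_prop))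
      (Eventually.of_forall fun y => ?_)
    have : (2 * Real.pi * ⟪y, ∑ n ∈ t, ξ n - ∑ n ∈ tᶜ, ξ n⟫ : ℂ) =
      ((2 * Real.pi * ⟪y, ∑ n ∈ t, ξ n - ∑ n ∈ tᶜ, ξ n⟫ : ℝ) : ℂ) := by push_cast; ring
    rw [this, Complex.norm_exp_ofReal_mul_I]

/-- The bipolar theorem: a closed convex set containing the origin contains the polar of its
polar. -/
theorem mem_of_forall_mem_polarBody {K : Set (EuclideanSpace ℝ (Fin d))} (hK : IsClosed K)
    (hKc : Convex ℝ K) (h0 : (0 : EuclideanSpace ℝ (Fin d)) ∈ K) {z : EuclideanSpace ℝ (Fin d)}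
    (hz : ∀ y ∈ polarBody K, ⟪z, y⟫ ≤ 1) : z ∈ K := by
  by_contra hzK
  obtain ⟨f, a, hf, ha⟩ := geometric_hahn_banach_closed_point hKc hK hzK
  have ha0 : 0 < a := by simpa using hf 0 h0
  let v := (InnerProductSpace.toDual ℝ (EuclideanSpace ℝ (Fin d))).symm f
  have hv : ∀ x, ⟪x, v⟫ = f x := fun x => by
    rw [real_inner_comm]; exact InnerProductSpace.toDual_symm_apply
  have h1 := hz (a⁻¹ • v) fun x hx => by
    rw [inner_smul_right, hv, inv_mul_le_iff₀ ha0, mul_one]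
    exact (hf x hx).le
  rw [inner_smul_right, hv, inv_mul_le_iff₀ ha0, mul_one] at h1
  linarith

theorem cosProd_mem_paleyWienerInfty_of_polarBody {K : Set (EuclideanSpace ℝ (Fin d))}
    (hK : IsClosed K) (hKc : Convex ℝ K) (h0 : (0 : EuclideanSpace ℝ (Fin d)) ∈ K)
    {ξ : Fin N → EuclideanSpace ℝ (Fin d)} (hξ : ∀ y ∈ polarBody K, ∑ n, |⟪ξ n, y⟫| ≤ 1) :
    cosProd ξ ∈ paleyWienerInfty K := by
  refine cosProd_mem_paleyWienerInfty hK fun t => mem_of_forall_mem_polarBody hK hKc h0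
    fun y hy => le_trans ?_ (hξ y hy)
  rw [inner_sub_left, sum_inner, sum_inner, ← Finset.sum_add_sum_compl t, sub_eq_add_neg,
    ← Finset.sum_neg_distrib]
  gcongr
  · exact le_abs_self _
  · exact neg_le_abs _

theorem zero_mem_interior_of_symm {K : Set (EuclideanSpace ℝ (Fin d))} (hKc : Convex ℝ K)
    (hK_int : (interior K).Nonempty) (hK_symm : ∀ x ∈ K, -x ∈ K) :
    (0 : EuclideanSpace ℝ (Fin d)) ∈ interior K := by
  obtain ⟨x, hx⟩ := hK_int
  have hneg : -K = K := by
    ext y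
    exact ⟨fun h => by simpa using hK_symm _ h, fun h => hK_symm y h⟩
  have hx' : -x ∈ interior K := by
    have h1 : interior (-K) = -interior K := (Homeomorph.neg _).preimage_interior K |>.symm
    rw [hneg] at h1
    rw [h1]
    simpa using hx
  have := hKc.interior hx hx' (by norm_num : (0 : ℝ) ≤ 1 / 2) (by norm_num : (0 : ℝ) ≤ 1 / 2)
    (by norm_num)
  simpa using this

theorem isCompact_polarBody {K : Set (EuclideanSpace ℝ (Fin d))}
    (h0 : (0 : EuclideanSpace ℝ (Fin d)) ∈ interior K) : IsCompact (polarBody K) := by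
  have hclosed : IsClosed (polarBody K) := by
    have : polarBody K = ⋂ x ∈ K, {y | ⟪x, y⟫ ≤ 1} := by ext; simp [polarBody]
    rw [this]
    exact isClosed_biInter fun x _ => isClosed_le (by fun_prop) continuous_const
  refine Metric.isCompact_of_isClosed_isBounded hclosed ?_
  obtain ⟨r, hr, hrK⟩ := Metric.mem_nhds_iff.1 (mem_interior_iff_mem_nhds.1 h0)
  refine (Metric.isBounded_closedBall (x := (0 : EuclideanSpace ℝ (Fin d))) (r := 2 / r)).subset ?_
  intro y hy
  rw [mem_closedBall_zero_iff]
  rcases eq_or_ne y 0 with rfl | hy0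
  · simp; positivity
  have hy0' : 0 < ‖y‖ := norm_pos_iff.2 hy0
  have h1 := hy ((r / 2 * ‖y‖⁻¹) • y) (hrK (by
    rw [mem_ball_zero_iff, norm_smul, Real.norm_eq_abs, abs_of_pos (by positivity), mul_assoc,
      inv_mul_cancel₀ hy0'.ne']
    linarith))
  rw [inner_smul_left, real_inner_self_eq_norm_sq] at h1
  simp only [conj_trivial] at h1
  have h2 : r / 2 * ‖y‖⁻¹ * ‖y‖ ^ 2 = r / 2 * ‖y‖ := by field_simp
  rw [h2] at h1
  rw [le_div_iff₀ hr]
  linarith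

end PaleyWiener

/-! ### Almost everywhere differentiability of the gauge and measurability of the normal. -/

section NormalVector

open scoped Pointwise

variable {d : ℕ}

theorem euclideanHausdorffMeasure_eq_zero_of_hausdorffMeasure {k : ℕ}
    {s : Set (EuclideanSpace ℝ (Fin d))} : μHE[k] s = 0 ↔ μH[(k : ℝ)] s = 0 := by
  rw [Measure.euclideanHausdorffMeasure_def, Measure.smul_apply]
  simp [Measure.addHaarScalarFactor_volume_hausdorffMeasure_ne_zero, ENNReal.smul_def]

/-- The hyperplane section of a null cone is null. -/
theorem euclideanHausdorffMeasure_inter_hyperplane_eq_zero_of_cone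
    {D : Set (EuclideanSpace ℝ (Fin d))} (hD : MeasurableSet D) (hD0 : volume D = 0)
    (hcone : ∀ x, ∀ t : ℝ, 0 < t → (t • x ∈ D ↔ x ∈ D)) {u : EuclideanSpace ℝ (Fin d)}
    (hu : ‖u‖ = 1) : μHE[d - 1] (D ∩ {x | ⟪x, u⟫ = 1}) = 0 := by
  set m := μHE[d - 1] (D ∩ {x | ⟪x, u⟫ = 1}) with hm
  -- Sections at heights $t>1$ are dilates of the one at height 1 and so at least as large; Fubini
  -- over $1<t<2$ then bounds the latter by the volume of the cone.
  have hslice : ∀ t : ℝ, 1 < t → m ≤ μHE[d - 1] (D ∩ {x | ⟪x, u⟫ = t}) := by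
    intro t ht
    have ht0 : 0 < t := one_pos.trans ht
    have heq : D ∩ {x | ⟪x, u⟫ = t} = t • (D ∩ {x | ⟪x, u⟫ = 1}) := by
      ext x
      rw [Set.mem_smul_set_iff_inv_smul_mem₀ ht0.ne']
      simp only [Set.mem_inter_iff, hcone x t⁻¹ (inv_pos.2 ht0), Set.mem_ofPred_eq,
        inner_smul_left, conj_trivial, inv_mul_eq_one₀ ht0.ne']
      rw [eq_comm (a := t)]
    rw [heq, Measure.euclideanHausdorffMeasure_smul₀ _ ht0.ne', ← hm, ENNReal.smul_def, smul_eq_mul]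
    refine le_mul_of_one_le_left zero_le ?_
    rw [ENNReal.coe_pow]
    refine one_le_pow₀ ?_
    have : (1 : ℝ≥0) ≤ ‖t‖₊ := by
      rw [← NNReal.coe_le_coe, coe_nnnorm, Real.norm_of_nonneg ht0.le]
      exact ht.le
    exact_mod_cast this
  have h := volume_eq_lintegral_hyperplane hu hD
  rw [hD0] at h
  have h2 : m ≤ 0 := by
    calc m = ∫⁻ _ in Set.Ioo (1 : ℝ) 2, m := by
          simp [Real.volume_Ioo]; norm_num
      _ ≤ ∫⁻ t in Set.Ioo (1 : ℝ) 2, μHE[d - 1] (D ∩ {x | ⟪x, u⟫ = t}) :=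
        setLIntegral_mono' measurableSet_Ioo fun t ht => hslice t ht.1
      _ ≤ 0 := by rw [h]; exact setLIntegral_le_lintegral _ _
  exact le_antisymm h2 zero_le

theorem exists_unit_inner_pos {x : EuclideanSpace ℝ (Fin d)} (hx : x ≠ 0) :
    ∃ i : Fin d × Bool, 0 < ⟪x, EuclideanSpace.single i.1 (if i.2 then (1 : ℝ) else -1)⟫ := by
  obtain ⟨i, hi⟩ : ∃ i, x i ≠ 0 := by
    by_contra! h
    exact hx (by ext i; simpa using h i)
  rcases lt_or_gt_of_ne hi with h | h
  · exact ⟨(i, false), by simpa [EuclideanSpace.inner_single_right] using h⟩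
  · exact ⟨(i, true), by simpa [EuclideanSpace.inner_single_right] using h⟩

variable {K : Set (EuclideanSpace ℝ (Fin d))}

theorem exists_mul_norm_le_gauge (hKb : Bornology.IsBounded K) (hK0 : K ∈ 𝓝 0) :
    ∃ c : ℝ, 0 < c ∧ ∀ x, c * ‖x‖ ≤ gauge K x := by
  obtain ⟨r, hr⟩ := hKb.subset_closedBall 0
  refine ⟨(max r 1)⁻¹, by positivity, fun x => ?_⟩
  rw [inv_mul_eq_div]
  exact le_gauge_of_subset_closedBall (absorbent_nhds_zero hK0) (by positivity)
    (hr.trans (Metric.closedBall_subset_closedBall (le_max_left _ _)))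

/-- Radial projection from a hyperplane not through the origin onto the boundary of a convex body
is Lipschitz. -/
theorem exists_lipschitzOnWith_radial (hKc : Convex ℝ K) (hKb : Bornology.IsBounded K)
    (hK0 : K ∈ 𝓝 0) : ∃ C : ℝ≥0, LipschitzOnWith C
      (fun x : EuclideanSpace ℝ (Fin d) => (gauge K x)⁻¹ • x) {x | 1 ≤ ‖x‖} := by
  obtain ⟨c, hc, hcK⟩ := exists_mul_norm_le_gauge hKb hK0
  obtain ⟨L, hL⟩ := hKc.lipschitz_gauge hK0
  refine ⟨(c⁻¹ + L * c⁻¹ * c⁻¹).toNNReal, LipschitzOnWith.of_dist_le_mul fun y hy z hz => ?_⟩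
  rw [Real.coe_toNNReal _ (by positivity)]
  have hpos : ∀ x : EuclideanSpace ℝ (Fin d), 1 ≤ ‖x‖ → c ≤ gauge K x := fun x hx =>
    le_trans (by nlinarith) (hcK x)
  have hy1 := hpos y hy
  have hz1 := hpos z hz
  have hy0 : 0 < gauge K y := hc.trans_le hy1
  have hz0 : 0 < gauge K z := hc.trans_le hz1
  have heq : (gauge K y)⁻¹ • y - (gauge K z)⁻¹ • z =
      (gauge K y)⁻¹ • (y - z) + ((gauge K z - gauge K y) * (gauge K y)⁻¹ * (gauge K z)⁻¹) • z := by
    have : (gauge K z - gauge K y) * (gauge K y)⁻¹ * (gauge K z)⁻¹ =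
      (gauge K y)⁻¹ - (gauge K z)⁻¹ := by field_simp
    rw [this, smul_sub, sub_smul]
    abel
  have h1 : |gauge K z - gauge K y| ≤ L * dist y z := by
    rw [dist_comm, ← Real.dist_eq]; exact hL.dist_le_mul z y
  have h2 : (gauge K y)⁻¹ ≤ c⁻¹ := inv_anti₀ hc hy1
  have h3 : (gauge K z)⁻¹ * ‖z‖ ≤ c⁻¹ := by
    rw [inv_mul_le_iff₀ hz0, ← div_eq_mul_inv, le_div_iff₀ hc, mul_comm]
    exact hcK z
  rw [dist_eq_norm, heq]
  calc _ ≤ ‖(gauge K y)⁻¹ • (y - z)‖ +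
        ‖((gauge K z - gauge K y) * (gauge K y)⁻¹ * (gauge K z)⁻¹) • z‖ := norm_add_le _ _
    _ = (gauge K y)⁻¹ * dist y z +
        |gauge K z - gauge K y| * (gauge K y)⁻¹ * ((gauge K z)⁻¹ * ‖z‖) := by
      rw [norm_smul, norm_smul, norm_mul, norm_mul, Real.norm_of_nonneg (inv_pos.2 hy0).le,
        Real.norm_of_nonneg (inv_pos.2 hz0).le, dist_eq_norm, Real.norm_eq_abs]
      ring
    _ ≤ c⁻¹ * dist y z + (L * dist y z) * c⁻¹ * c⁻¹ := by
      have : 0 ≤ (gauge K y)⁻¹ := (inv_pos.2 hy0).le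
      gcongr
    _ = _ := by ring

theorem differentiableAt_gauge_smul_iff (x : EuclideanSpace ℝ (Fin d)) {t : ℝ} (ht : 0 < t) :
    DifferentiableAt ℝ (gauge K) (t • x) ↔ DifferentiableAt ℝ (gauge K) x := by
  have key : ∀ (y : EuclideanSpace ℝ (Fin d)) (a : ℝ), 0 < a →
      DifferentiableAt ℝ (gauge K) (a • y) → DifferentiableAt ℝ (gauge K) y := by
    intro y a ha h
    have h1 : DifferentiableAt ℝ (fun z => a⁻¹ * gauge K (a • z)) y :=
      (h.comp y (differentiableAt_id.const_smul a)).const_mul a⁻¹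
    convert h1 using 2 with z
    rw [gauge_smul_of_nonneg ha.le, smul_eq_mul, inv_mul_cancel_left₀ ha.ne']
  refine ⟨key x t ht, fun h => key (t • x) t⁻¹ (inv_pos.2 ht) ?_⟩
  rwa [inv_smul_smul₀ ht.ne']

/-- The gauge of a convex body is differentiable almost everywhere on its boundary. -/
theorem ae_frontier_differentiableAt_gauge (hKc : Convex ℝ K) (hKb : Bornology.IsBounded K)
    (hK0 : K ∈ 𝓝 0) :
    ∀ᵐ x ∂(μHE[d - 1] : Measure (EuclideanSpace ℝ (Fin d))).restrict (frontier K),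
      DifferentiableAt ℝ (gauge K) x := by
  obtain ⟨L, hL⟩ := hKc.lipschitz_gauge hK0
  obtain ⟨C, hC⟩ := exists_lipschitzOnWith_radial hKc hKb hK0
  let D : Set (EuclideanSpace ℝ (Fin d)) := {x | ¬ DifferentiableAt ℝ (gauge K) x}
  have hD : MeasurableSet D := (measurableSet_of_differentiableAt ℝ (gauge K)).compl
  have hD0 : volume D = 0 := hL.ae_differentiableAt
  have hcone : ∀ x, ∀ t : ℝ, 0 < t → (t • x ∈ D ↔ x ∈ D) := fun x t ht =>
    not_congr (differentiableAt_gauge_smul_iff x ht)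
  rw [ae_restrict_iff' isClosed_frontier.measurableSet, ae_iff]
  let e : Fin d × Bool → EuclideanSpace ℝ (Fin d) := fun i =>
    EuclideanSpace.single i.1 (if i.2 then (1 : ℝ) else -1)
  have he : ∀ i, ‖e i‖ = 1 := by
    rintro ⟨i, _ | _⟩ <;> simp [e]
  -- The exceptional set is a cone, null by Rademacher. The boundary is covered by radial
  -- projections from the $2d$ hyperplanes $\langle x,\pm e_i\rangle=1$, and these Lipschitz maps
  -- preserve null sets.
  refine measure_mono_null (t := ⋃ i, (fun x => (gauge K x)⁻¹ • x) '' (D ∩ {x | ⟪x, e i⟫ = 1})) ?_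
    (measure_iUnion_null fun i => ?_)
  · intro x hx
    simp only [Set.mem_ofPred_eq, Classical.not_imp] at hx
    have hx1 : gauge K x = 1 := (gauge_eq_one_iff_mem_frontier hKc hK0).2 hx.1
    have hx0 : x ≠ 0 := by rintro rfl; simp at hx1
    obtain ⟨i, hi⟩ := exists_unit_inner_pos hx0
    refine Set.mem_iUnion.2 ⟨i, ⟪x, e i⟫⁻¹ • x, ⟨(hcone _ _ (inv_pos.2 hi)).2 hx.2, ?_⟩, ?_⟩
    · simp only [Set.mem_ofPred_eq, inner_smul_left, conj_trivial]
      exact inv_mul_cancel₀ hi.ne'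
    · simp only
      rw [gauge_smul_of_nonneg (inv_pos.2 hi).le, hx1, smul_eq_mul, mul_one, inv_inv,
        smul_inv_smul₀ hi.ne']
  · have h1 := euclideanHausdorffMeasure_inter_hyperplane_eq_zero_of_cone hD hD0 hcone (he i)
    rw [euclideanHausdorffMeasure_eq_zero_of_hausdorffMeasure] at h1 ⊢
    have h2 : LipschitzOnWith C (fun x => (gauge K x)⁻¹ • x) (D ∩ {x | ⟪x, e i⟫ = 1}) := by
      refine hC.mono fun x hx => ?_
      have := real_inner_le_norm x (e i)
      rw [he i, mul_one, hx.2] at this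
      exact this
    refine le_antisymm ((h2.hausdorffMeasure_image_le (Nat.cast_nonneg _)).trans ?_) zero_le
    rw [h1, mul_zero]

theorem IsOutwardUnitNormal.inner_le_gauge_mul (hKc : Convex ℝ K) (hKcl : IsClosed K)
    (hKb : Bornology.IsBounded K) (hK0 : K ∈ 𝓝 0) {x v : EuclideanSpace ℝ (Fin d)}
    (hv : IsOutwardUnitNormal K x v) (y : EuclideanSpace ℝ (Fin d)) :
    ⟪y, v⟫ ≤ gauge K y * ⟪x, v⟫ := by
  obtain ⟨c, hc, hcK⟩ := exists_mul_norm_le_gauge hKb hK0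
  rcases eq_or_ne y 0 with rfl | hy
  · simp
  have hy0 : 0 < gauge K y := lt_of_lt_of_le (by positivity) (hcK y)
  have hmem : (gauge K y)⁻¹ • y ∈ K := by
    have h1 : gauge K ((gauge K y)⁻¹ • y) ≤ 1 := by
      rw [gauge_smul_of_nonneg (inv_pos.2 hy0).le, smul_eq_mul, inv_mul_cancel₀ hy0.ne']
    rw [gauge_le_one_iff_mem_closure hKc hK0, hKcl.closure_eq] at h1
    exact h1
  have h := hv.2 _ hmem
  rw [inner_sub_left, inner_smul_left, sub_nonpos] at h
  simp only [conj_trivial] at h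
  rwa [inv_mul_le_iff₀ hy0] at h

/-- At a boundary point where the gauge is differentiable, the outward unit normal is its
normalised gradient. -/
theorem IsOutwardUnitNormal.eq_gradient_gauge (hKc : Convex ℝ K) (hKcl : IsClosed K)
    (hKb : Bornology.IsBounded K) (hK0 : K ∈ 𝓝 0) {x v : EuclideanSpace ℝ (Fin d)}
    (hx : x ∈ frontier K) (hv : IsOutwardUnitNormal K x v)
    (hdiff : DifferentiableAt ℝ (gauge K) x) :
    v = ‖gradient (gauge K) x‖⁻¹ • gradient (gauge K) x := by
  have hx1 : gauge K x = 1 := (gauge_eq_one_iff_mem_frontier hKc hK0).2 hx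
  -- The supporting hyperplane inequality, extended by homogeneity, says this function is
  -- nonnegative, with value $0$ at $x$; its derivative there vanishes, so $v$ is a multiple of the
  -- gradient.
  have hmin : IsLocalMin (fun y => ⟪x, v⟫ * gauge K y - ⟪v, y⟫) x := by
    refine Eventually.of_forall fun y => ?_
    have := hv.inner_le_gauge_mul hKc hKcl hKb hK0 y
    simp only [hx1, mul_one, real_inner_comm x v, sub_self]
    rw [real_inner_comm, mul_comm] at this
    linarith
  have hder : HasFDerivAt (fun y => ⟪x, v⟫ * gauge K y - ⟪v, y⟫)
      (⟪x, v⟫ • fderiv ℝ (gauge K) x - innerSL ℝ v) x :=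
    (hdiff.hasFDerivAt.const_mul _).sub (innerSL ℝ v).hasFDerivAt
  have hzero := hmin.hasFDerivAt_eq_zero hder
  have hgrad : ⟪x, v⟫ • gradient (gauge K) x = v := by
    refine ext_inner_right ℝ fun y => ?_
    have := congrArg (fun f : EuclideanSpace ℝ (Fin d) →L[ℝ] ℝ => f y) hzero
    simp only [sub_apply, smul_apply,
      zero_apply, innerSL_apply_apply, smul_eq_mul] at this
    rw [inner_smul_left, gradient, InnerProductSpace.toDual_symm_apply, conj_trivial]
    linarith
  have hpos : 0 ≤ ⟪x, v⟫ := by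
    have := hv.2 0 (mem_of_mem_nhds hK0)
    rw [zero_sub, inner_neg_left] at this
    linarith
  have hn : ⟪x, v⟫ * ‖gradient (gauge K) x‖ = 1 := by
    rw [← hv.1, ← hgrad, norm_smul, Real.norm_of_nonneg hpos, hgrad]
  rw [← eq_inv_of_mul_eq_one_left hn, hgrad]

theorem aemeasurable_outwardUnitNormal (hKc : Convex ℝ K) (hKcl : IsClosed K)
    (hKb : Bornology.IsBounded K) (hK0 : K ∈ 𝓝 0)
    {ν : EuclideanSpace ℝ (Fin d) → EuclideanSpace ℝ (Fin d)}
    (hν : ∀ x ∈ frontier K, IsOutwardUnitNormal K x (ν x)) :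
    AEMeasurable ν
      ((μHE[d - 1] : Measure (EuclideanSpace ℝ (Fin d))).restrict (frontier K)) := by
  have hgrad : Measurable (gradient (gauge K)) :=
    (InnerProductSpace.toDual ℝ (EuclideanSpace ℝ (Fin d))).symm.continuous.measurable.comp
      (measurable_fderiv ℝ (gauge K))
  refine ⟨fun x => ‖gradient (gauge K) x‖⁻¹ • gradient (gauge K) x,
    hgrad.norm.inv.smul hgrad, ?_⟩
  filter_upwards [ae_frontier_differentiableAt_gauge hKc hKb hK0,
    ae_restrict_mem isClosed_frontier.measurableSet] with x hx hxK
  exact (hν x hxK).eq_gradient_gauge hKc hKcl hKb hK0 hxK hx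

end NormalVector

/-! ### Random sampling of boundary points. -/

section Sampling

/-- The strong law of large numbers for independent samples of a vector-valued function. -/
theorem ae_infinitePi_tendsto_average {X F : Type*} [MeasurableSpace X] [NormedAddCommGroup F]
    [NormedSpace ℝ F] [CompleteSpace F] (P : Measure X) [IsProbabilityMeasure P] {H : X → F}
    (hH : Integrable H P) :
    ∀ᵐ ω ∂(Measure.infinitePi fun _ : ℕ => P),
      Tendsto (fun n : ℕ => (n : ℝ)⁻¹ • ∑ i ∈ Finset.range n, H (ω i)) atTop
        (𝓝 (∫ x, H x ∂P)) := by
  borelize F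
  obtain ⟨H', hH's, hae⟩ := hH.1
  have hH'm : Measurable H' := hH's.measurable
  have hH' : Integrable H' P := hH.congr hae
  have hmp : ∀ i : ℕ, MeasurePreserving (fun ω : ℕ → X => ω i)
      (Measure.infinitePi fun _ : ℕ => P) P := fun i =>
    measurePreserving_eval_infinitePi (fun _ : ℕ => P) i
  have hint : ∀ i : ℕ, Integrable (fun ω : ℕ → X => H' (ω i))
      (Measure.infinitePi fun _ : ℕ => P) := fun i => (hmp i).integrable_comp_of_integrable hH'
  have hlaw := ProbabilityTheory.strong_law_ae (μ := Measure.infinitePi fun _ : ℕ => P)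
    (fun i ω => H' (ω i)) (hint 0)
    (fun i j hij => (ProbabilityTheory.iIndepFun_infinitePi (P := fun _ : ℕ => P)
      (X := fun _ => H') fun _ => hH'm).indepFun hij)
    (fun i => ⟨(hint i).1.aemeasurable, (hint 0).1.aemeasurable, by
      change Measure.map (H' ∘ fun ω : ℕ → X => ω i) _ = Measure.map (H' ∘ fun ω : ℕ → X => ω 0) _
      rw [← Measure.map_map hH'm (hmp i).measurable, ← Measure.map_map hH'm (hmp 0).measurable,
        (hmp i).map_eq, (hmp 0).map_eq]⟩)
  have heq : ∀ᵐ ω ∂(Measure.infinitePi fun _ : ℕ => P), ∀ i, H (ω i) = H' (ω i) :=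
    ae_all_iff.2 fun i => (hmp i).quasiMeasurePreserving.ae hae
  have hmean : ∫ ω, H' (ω 0) ∂(Measure.infinitePi fun _ : ℕ => P) = ∫ x, H x ∂P := by
    rw [integral_congr_ae hae]
    have h := integral_map (hmp 0).aemeasurable (f := H')
      (by rw [(hmp 0).map_eq]; exact hH's.aestronglyMeasurable)
    rw [(hmp 0).map_eq] at h
    exact h.symm
  rw [hmean] at hlaw
  filter_upwards [hlaw, heq] with ω h1 h2
  simpa only [h2] using h1

/-- Two coordinates have law $P\times P$, and by Fubini an atomless second coordinate avoids $\pm$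
the first. -/
theorem ae_infinitePi_ne_and_ne_neg {X : Type*} [MeasurableSpace X] [AddGroup X]
    [MeasurableNeg X] [MeasurableEq X] (P : Measure X)
    [IsProbabilityMeasure P] (hP : ∀ x, P {x} = 0) :
    ∀ᵐ ω ∂(Measure.infinitePi fun _ : ℕ => P), ∀ i j, i ≠ j → ω i ≠ ω j ∧ ω i ≠ -ω j := by
  refine ae_all_iff.2 fun i => ae_all_iff.2 fun j => ?_
  by_cases hij : i = j
  · exact Eventually.of_forall fun ω h => absurd hij h
  have hmeas : MeasurableSet {p : X × X | p.1 ≠ p.2 ∧ p.1 ≠ -p.2} :=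
    (measurableSet_eq_fun measurable_fst measurable_snd).compl.inter
      (measurableSet_eq_fun measurable_fst measurable_snd.neg).compl
  have h : ∀ᵐ p ∂(P.prod P), p.1 ≠ p.2 ∧ p.1 ≠ -p.2 := by
    rw [Measure.ae_prod_iff_ae_ae hmeas]
    refine Eventually.of_forall fun x => ?_
    have h1 : ∀ᵐ y ∂P, y ≠ x := by simpa [ae_iff] using hP x
    have h2 : ∀ᵐ y ∂P, y ≠ -x := by simpa [ae_iff] using hP (-x)
    filter_upwards [h1, h2] with y hy1 hy2
    exact ⟨hy1.symm, fun h => hy2 (by rw [h, neg_neg])⟩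
  rw [← Measure.infinitePi_map_eval_prod (P := fun _ : ℕ => P) hij] at h
  filter_upwards [ae_of_ae_map (by fun_prop) h] with ω hω _
  exact hω

variable {d : ℕ}

theorem euclideanHausdorffMeasure_singleton {k : ℕ} (hk : 0 < k) (x : EuclideanSpace ℝ (Fin d)) :
    μHE[k] {x} = 0 := by
  rw [euclideanHausdorffMeasure_eq_zero_of_hausdorffMeasure]
  have := Measure.nullSingletonClass_hausdorff (EuclideanSpace ℝ (Fin d)) (d := k)
    (by exact_mod_cast hk)
  exact measure_singleton x

variable {K : Set (EuclideanSpace ℝ (Fin d))}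

/-- Finitely many points of the boundary, distinct up to sign, whose averages approximate the
surface mean of `g` and, uniformly over the polar body, the means of `|⟨ν, y⟩| g`. -/
theorem exists_sample_points (hd : 2 ≤ d) (hKc : Convex ℝ K) (hK : IsCompact K)
    (h0 : (0 : EuclideanSpace ℝ (Fin d)) ∈ interior K)
    {ν : EuclideanSpace ℝ (Fin d) → EuclideanSpace ℝ (Fin d)}
    (hν : ∀ x ∈ frontier K, IsOutwardUnitNormal K x (ν x))
    {g : EuclideanSpace ℝ (Fin d) → ℝ} (hg : ContinuousOn g (frontier K))
    (hg0 : ∀ x ∈ frontier K, 0 ≤ g x)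
    (hfin : (μHE[d - 1] : Measure (EuclideanSpace ℝ (Fin d))).real (frontier K) ≠ 0)
    {η : ℝ} (hη : 0 < η) :
    ∃ (N : ℕ) (p : Fin N → EuclideanSpace ℝ (Fin d)), 0 < N ∧ (∀ n, p n ∈ frontier K) ∧
      (∀ m n, m ≠ n → p m ≠ p n ∧ p m ≠ -p n) ∧
      surfaceMean K g - η < (N : ℝ)⁻¹ * ∑ n, g (p n) ∧
      ∀ y ∈ polarBody K,
        (N : ℝ)⁻¹ * ∑ n, |⟪ν (p n), y⟫| * g (p n) ≤ polarSup K ν g + η := by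
  have hK0 : K ∈ 𝓝 0 := mem_interior_iff_mem_nhds.1 h0
  have hKf : IsCompact (frontier K) := hK.of_isClosed_subset isClosed_frontier
    hK.isClosed.frontier_subset
  have hfm : MeasurableSet (frontier K) := isClosed_frontier.measurableSet
  have : CompactSpace (polarBody K) := isCompact_iff_compactSpace.1 (isCompact_polarBody h0)
  let σ : Measure (EuclideanSpace ℝ (Fin d)) := μHE[d - 1].restrict (frontier K)
  have hσ1 : σ Set.univ = μHE[d - 1] (frontier K) := by simp [σ]
  have hσfin : IsFiniteMeasure σ := ⟨by
    rw [hσ1, lt_top_iff_ne_top]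
    intro h
    exact hfin (by simp [Measure.real, h])⟩
  have hσ0 : NeZero σ := ⟨by
    intro h
    rw [h] at hσ1
    exact hfin (by simp [Measure.real, ← hσ1])⟩
  let P : Measure (EuclideanSpace ℝ (Fin d)) := (σ Set.univ)⁻¹ • σ
  have hP : IsProbabilityMeasure P := inferInstance
  have hPac : P ≪ σ := Measure.smul_absolutelyContinuous
  have hPf : ∀ᵐ x ∂P, x ∈ frontier K := hPac.ae_le (ae_restrict_mem hfm)
  have hPint : ∀ F : EuclideanSpace ℝ (Fin d) → ℝ,
      ∫ x, F x ∂P = ((μHE[d - 1] : Measure (EuclideanSpace ℝ (Fin d))).real (frontier K))⁻¹ *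
        ∫ x in frontier K, F x ∂μHE[d - 1] := by
    intro F
    simp only [P]
    rw [integral_smul_measure, hσ1, ENNReal.toReal_inv, smul_eq_mul]
    rfl
  have hνm : AEMeasurable ν P :=
    (aemeasurable_outwardUnitNormal hKc hK.isClosed hK.isBounded hK0 hν).mono_ac hPac
  have hgm : AEMeasurable g P := (hg.aemeasurable hfm).mono_ac hPac
  obtain ⟨G, hG⟩ := hKf.exists_bound_of_continuousOn hg
  have hG' : ∀ x ∈ frontier K, g x ≤ |G| := fun x hx =>
    (le_abs_self _).trans ((hG x hx).trans (le_abs_self _))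
  obtain ⟨R, hR⟩ := (isCompact_polarBody h0).isBounded.exists_norm_le
  have hbound : ∀ x ∈ frontier K, ∀ y ∈ polarBody K, |⟪ν x, y⟫| * g x ≤ |R| * |G| := by
    intro x hx y hy
    have h1 : |⟪ν x, y⟫| ≤ |R| := by
      refine (abs_real_inner_le_norm _ _).trans ?_
      rw [(hν x hx).1, one_mul]
      exact (hR y hy).trans (le_abs_self _)
    have := hg0 x hx
    have := hG' x hx
    gcongr
  -- Currying gives a continuous map into $C(K^\circ)$, so the random function of $y$ is strongly
  -- measurable as soon as $\nu$ and $g$ are measurable, and its law of large numbers is uniform in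
  -- $y$.
  let Ψ : C(EuclideanSpace ℝ (Fin d) × ℝ, C(polarBody K, ℝ)) := ContinuousMap.curry
    ⟨fun q => |⟪q.1.1, (q.2 : EuclideanSpace ℝ (Fin d))⟫| * q.1.2, by fun_prop⟩
  let h : EuclideanSpace ℝ (Fin d) → C(polarBody K, ℝ) := fun x => Ψ (ν x, g x)
  have hh : ∀ x (y : polarBody K), h x y = |⟪ν x, (y : EuclideanSpace ℝ (Fin d))⟫| * g x :=
    fun x y => rfl
  have hint : Integrable h P := by
    refine Integrable.of_bound (Ψ.continuous.comp_aestronglyMeasurable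
      (hνm.aestronglyMeasurable.prodMk hgm.aestronglyMeasurable)) (|R| * |G|) ?_
    filter_upwards [hPf] with x hx
    rw [ContinuousMap.norm_le _ (by positivity)]
    intro y
    rw [hh, Real.norm_of_nonneg (mul_nonneg (abs_nonneg _) (hg0 x hx))]
    exact hbound x hx y y.2
  have hgint : Integrable g P := by
    refine Integrable.of_bound hgm.aestronglyMeasurable G ?_
    filter_upwards [hPf] with x hx using hG x hx
  have hmean : ∫ x, g x ∂P = surfaceMean K g := rfl
  have hsup : ∀ y : polarBody K, (∫ x, h x ∂P) y ≤ polarSup K ν g := by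
    intro y
    rw [ContinuousMap.integral_apply hint]
    simp only [hh]
    rw [hPint, polarSup]
    refine mul_le_mul_of_nonneg_left (le_ciSup (f := fun y : polarBody K =>
      ∫ x in frontier K, |⟪ν x, (y : EuclideanSpace ℝ (Fin d))⟫| * g x ∂μHE[d - 1]) ?_ y)
      (inv_nonneg.2 measureReal_nonneg)
    refine ⟨|R| * |G| * σ.real Set.univ, ?_⟩
    rintro _ ⟨y, rfl⟩
    refine (le_abs_self _).trans ?_
    rw [← Real.norm_eq_abs]
    refine norm_integral_le_of_norm_le_const ?_
    filter_upwards [ae_restrict_mem hfm] with x hx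
    rw [Real.norm_of_nonneg (mul_nonneg (abs_nonneg _) (hg0 x hx))]
    exact hbound x hx y y.2
  have hPsing : ∀ x, P {x} = 0 := fun x => hPac (by
    refine measure_mono_null (t := {x}) subset_rfl (le_antisymm ?_ zero_le)
    refine (Measure.restrict_apply_le _ _).trans ?_
    rw [euclideanHausdorffMeasure_singleton (by omega)])
  have hall : ∀ᵐ ω ∂(Measure.infinitePi fun _ : ℕ => P), ∀ i, ω i ∈ frontier K :=
    ae_all_iff.2 fun i =>
      (measurePreserving_eval_infinitePi (fun _ : ℕ => P) i).quasiMeasurePreserving.ae hPf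
  obtain ⟨ω, hω1, hω2, hω3, hω4⟩ := (hall.and ((ae_infinitePi_ne_and_ne_neg P hPsing).and
    ((ae_infinitePi_tendsto_average P hgint).and (ae_infinitePi_tendsto_average P hint)))).exists
  rw [hmean] at hω3
  obtain ⟨N, hN0, hN1, hN2⟩ := ((eventually_gt_atTop 0).and
    ((hω3.eventually (lt_mem_nhds (sub_lt_self _ hη))).and
      (hω4.eventually (Metric.ball_mem_nhds _ hη)))).exists
  refine ⟨N, fun n => ω n, hN0, fun n => hω1 n, fun m n hmn => hω2 m n ?_, ?_, ?_⟩
  · exact fun h => hmn (Fin.ext h)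
  · rw [Fin.sum_univ_eq_sum_range (fun n => g (ω n))]
    exact hN1
  · intro y hy
    have h1 := ContinuousMap.dist_apply_le_dist (f := (N : ℝ)⁻¹ • ∑ i ∈ Finset.range N, h (ω i))
      (g := ∫ x, h x ∂P) ⟨y, hy⟩
    have h2 := h1.trans_lt hN2
    rw [Real.dist_eq] at h2
    have h3 := (le_abs_self _).trans_lt h2
    rw [ContinuousMap.smul_apply, ContinuousMap.sum_apply, smul_eq_mul] at h3
    simp only [hh] at h3
    rw [Fin.sum_univ_eq_sum_range (fun n => |⟪ν (ω n), y⟫| * g (ω n))]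
    linarith [hsup ⟨y, hy⟩]

end Sampling

/-! ### Non-parallel normals and the choice of parameters. -/

section Main

variable {d : ℕ} {K : Set (EuclideanSpace ℝ (Fin d))}

/-- A strictly convex set has at most one boundary point with a given outward normal. -/
theorem IsOutwardUnitNormal.eq_of_strictConvex (hK : StrictConvex ℝ K)
    {x y v : EuclideanSpace ℝ (Fin d)} (hx : x ∈ K) (hy : y ∈ K)
    (hxv : IsOutwardUnitNormal K x v) (hyv : IsOutwardUnitNormal K y v) : x = y := by
  by_contra hxy
  have hm : (1 / 2 : ℝ) • x + (1 / 2 : ℝ) • y ∈ interior K :=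
    hK hx hy hxy (by norm_num) (by norm_num) (by norm_num)
  set m := (1 / 2 : ℝ) • x + (1 / 2 : ℝ) • y with hmd
  have hcont : Tendsto (fun t : ℝ => m + t • v) (𝓝[>] 0) (𝓝 m) := by
    have h : Continuous fun t : ℝ => m + t • v := by fun_prop
    have := h.tendsto 0
    simp only [zero_smul, add_zero] at this
    exact this.mono_left nhdsWithin_le_nhds
  obtain ⟨t, ht, ht0⟩ := ((hcont.eventually (mem_interior_iff_mem_nhds.1 hm)).and
    self_mem_nhdsWithin).exists
  have h1 := hxv.2 _ ht
  have h2 := hyv.2 _ ht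
  -- Averaging the two normal inequalities at $m+tv\in K$ gives $t\le0$.
  rw [inner_sub_left, inner_add_left, inner_smul_left, real_inner_self_eq_norm_sq, hxv.1] at h1 h2
  simp only [hmd, inner_add_left, inner_smul_left, conj_trivial] at h1 h2
  linarith

theorem IsOutwardUnitNormal.neg (hK_symm : ∀ x ∈ K, -x ∈ K) {x v : EuclideanSpace ℝ (Fin d)}
    (hv : IsOutwardUnitNormal K x v) : IsOutwardUnitNormal K (-x) (-v) := by
  refine ⟨by rw [norm_neg, hv.1], fun y hy => ?_⟩
  have := hv.2 (-y) (hK_symm y hy)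
  rw [inner_sub_left, inner_neg_left] at this
  rw [inner_neg_right, inner_sub_left, inner_neg_left]
  linarith

theorem exists_grid_in_zeros (hd : d ≠ 0) (hK_strict : StrictConvex ℝ K) (hKcl : IsClosed K)
    (hK_symm : ∀ x ∈ K, -x ∈ K) {ν : EuclideanSpace ℝ (Fin d) → EuclideanSpace ℝ (Fin d)}
    (hν : ∀ x ∈ frontier K, IsOutwardUnitNormal K x (ν x))
    {g : EuclideanSpace ℝ (Fin d) → ℝ} (hg0 : ∀ x ∈ frontier K, 0 ≤ g x)
    {N : ℕ} (hN : 0 < N) {α : ℝ} (hα : 0 < α) {p : Fin N → EuclideanSpace ℝ (Fin d)}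
    (hp : ∀ n, p n ∈ frontier K) (hpp : ∀ m n, m ≠ n → p m ≠ p n ∧ p m ≠ -p n)
    {c : ℝ} (hc : 0 < c) (hcg : c < 2 * α * ((N : ℝ)⁻¹ * ∑ n, g (p n))) :
    ∃ (φ : ℝ≥0 → ℝ≥0) (Γ : Set (EuclideanSpace ℝ (Fin d))),
      Continuous φ ∧ φ 0 = 1 ∧ IsPhiRegular φ Γ ∧
      Γ ⊆ {x | cosProd (fun n => (α * g (p n) / N) • ν (p n)) x = 0} ∧
      ENNReal.ofReal c ≤ lowerSurfaceDensity Γ := by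
  classical
  have hN' : (0 : ℝ) < N := by exact_mod_cast hN
  -- Points with $g=0$ give the constant factor 1 and contribute neither zeros nor density.
  let ι := {n : Fin N // 0 < g (p n)}
  let u : ι → EuclideanSpace ℝ (Fin d) := fun i => ν (p i)
  let s : ι → ℝ := fun i => N / (2 * α * g (p i))
  have hmem : ∀ n, p n ∈ K := fun n => hKcl.frontier_subset (hp n)
  have hu : ∀ i, ‖u i‖ = 1 := fun i => (hν _ (hp i)).1
  have hs : ∀ i, 0 < s i := fun i => by
    have := i.2
    positivity
  have hne : ∀ i j, i ≠ j → u i ≠ u j ∧ u i ≠ -u j := by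
    intro i j hij
    have hij' : (i : Fin N) ≠ j := fun h => hij (Subtype.ext h)
    refine ⟨fun h => (hpp i j hij').1 ?_, fun h => (hpp i j hij').2 ?_⟩
    · refine IsOutwardUnitNormal.eq_of_strictConvex hK_strict (hmem i) (hmem j)
        (hν _ (hp i)) ?_
      change IsOutwardUnitNormal K (p j) (u i)
      rw [h]
      exact hν _ (hp j)
    · refine IsOutwardUnitNormal.eq_of_strictConvex hK_strict (hmem i) (hK_symm _ (hmem j))
        (hν _ (hp i)) ?_
      change IsOutwardUnitNormal K (-p j) (u i)
      rw [h]
      exact (hν _ (hp j)).neg hK_symm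
  have hsum : ∑ i, (s i)⁻¹ = 2 * α * ((N : ℝ)⁻¹ * ∑ n, g (p n)) := by
    have h1 : ∀ i : ι, (s i)⁻¹ = 2 * α * (N : ℝ)⁻¹ * g (p i) := fun i => by
      simp only [s, inv_div]
      field_simp
    have h2 : ∑ i : ι, g (p i) = ∑ n, g (p n) := by
      rw [← Finset.sum_subtype (Finset.univ.filter fun n => 0 < g (p n)) (by simp)
        (fun n => g (p n))]
      refine Finset.sum_filter_of_ne fun n _ h => (hg0 _ (hp n)).lt_of_ne' h
    simp_rw [h1]
    rw [← Finset.mul_sum, h2]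
    ring
  obtain ⟨δ, hδ, hδs, hden⟩ := exists_thinnedGrid_density hd hu hne hs hc (hsum ▸ hcg)
  obtain ⟨φ, hφ, hφ0, hreg⟩ := thinnedGrid_isPhiRegular hu hδs hδ
  refine ⟨φ, _, hφ, hφ0, hreg, fun x hx => ?_, hden⟩
  obtain ⟨i, hi⟩ := Set.mem_iUnion.1 hx
  obtain ⟨k, hk⟩ := hi.1
  rw [Set.mem_ofPred_eq, cosProd, Complex.ofReal_eq_zero]
  refine Finset.prod_eq_zero (Finset.mem_univ (i : Fin N)) ?_
  rw [Real.cos_eq_zero_iff]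
  refine ⟨k, ?_⟩
  have hgi : 0 < g (p i) := i.2
  change ⟪x, ν (p i)⟫ = (k + 1 / 2) * (N / (2 * α * g (p i))) at hk
  rw [inner_smul_right, hk]
  field_simp

end Main

theorem mainTheorem3 (d : ℕ) (hd : 2 ≤ d) (K : Set (EuclideanSpace ℝ (Fin d)))
    (hK_compact : IsCompact K) (hK_strict : StrictConvex ℝ K) (hK_int : (interior K).Nonempty)
    (hK_symm : ∀ x ∈ K, -x ∈ K)
    (ν : EuclideanSpace ℝ (Fin d) → EuclideanSpace ℝ (Fin d))
    (hν : ∀ x ∈ frontier K, IsOutwardUnitNormal K x (ν x))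
    (g : EuclideanSpace ℝ (Fin d) → ℝ) (hg_cont : ContinuousOn g (frontier K))
    (hg_nonneg : ∀ x ∈ frontier K, 0 ≤ g x) (ε : ℝ) (hε : 0 < ε) :
    ∃ f ∈ paleyWienerInfty K,
      ‖f 0‖ = 1 ∧ eLpNorm f ∞ volume = 1 ∧
      (∃ (N : ℕ) (α : ℝ) (p : Fin N → EuclideanSpace ℝ (Fin d)),
        0 < N ∧ 0 < α ∧ (∀ n, p n ∈ frontier K) ∧
        ∀ x, f x = ((∏ n, Real.cos (2 * Real.pi * (α * g (p n) / N) * ⟪x, ν (p n)⟫) : ℝ) : ℂ)) ∧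
      ∃ (φ : ℝ≥0 → ℝ≥0) (Γ : Set (EuclideanSpace ℝ (Fin d))),
        Continuous φ ∧ φ 0 = 1 ∧ IsPhiRegular φ Γ ∧ Γ ⊆ {x | f x = 0} ∧
        ENNReal.ofReal (2 * surfaceMean K g / polarSup K ν g - ε) ≤ lowerSurfaceDensity Γ := by
  have hKc := hK_strict.convex
  have h0 := zero_mem_interior_of_symm hKc hK_int hK_symm
  have hform : ∀ (N : ℕ) (α : ℝ) (p : Fin N → EuclideanSpace ℝ (Fin d)), 0 < N → 0 < α →
      (∀ n, p n ∈ frontier K) →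
      (∀ y ∈ polarBody K, α * ((N : ℝ)⁻¹ * ∑ n, |⟪ν (p n), y⟫| * g (p n)) ≤ 1) →
      (∃ (φ : ℝ≥0 → ℝ≥0) (Γ : Set (EuclideanSpace ℝ (Fin d))),
        Continuous φ ∧ φ 0 = 1 ∧ IsPhiRegular φ Γ ∧
        Γ ⊆ {x | cosProd (fun n => (α * g (p n) / N) • ν (p n)) x = 0} ∧
        ENNReal.ofReal (2 * surfaceMean K g / polarSup K ν g - ε) ≤ lowerSurfaceDensity Γ) →
      ∃ f ∈ paleyWienerInfty K,
        ‖f 0‖ = 1 ∧ eLpNorm f ∞ volume = 1 ∧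
        (∃ (N : ℕ) (α : ℝ) (p : Fin N → EuclideanSpace ℝ (Fin d)),
          0 < N ∧ 0 < α ∧ (∀ n, p n ∈ frontier K) ∧
          ∀ x, f x =
            ((∏ n, Real.cos (2 * Real.pi * (α * g (p n) / N) * ⟪x, ν (p n)⟫) : ℝ) : ℂ)) ∧
        ∃ (φ : ℝ≥0 → ℝ≥0) (Γ : Set (EuclideanSpace ℝ (Fin d))),
          Continuous φ ∧ φ 0 = 1 ∧ IsPhiRegular φ Γ ∧ Γ ⊆ {x | f x = 0} ∧
          ENNReal.ofReal (2 * surfaceMean K g / polarSup K ν g - ε) ≤ lowerSurfaceDensity Γ := by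
    intro N α p hN hα hp hy hΓ
    refine ⟨_, cosProd_mem_paleyWienerInfty_of_polarBody hK_compact.isClosed hKc
      (interior_subset h0) fun y hyK => le_trans (le_of_eq ?_) (hy y hyK),
      by simp, eLpNorm_top_cosProd _, ⟨N, α, p, hN, hα, hp, fun x => ?_⟩, hΓ⟩
    · rw [Finset.mul_sum, Finset.mul_sum]
      refine Finset.sum_congr rfl fun n _ => ?_
      have := hg_nonneg _ (hp n)
      rw [inner_smul_left, conj_trivial, abs_mul, abs_of_nonneg (by positivity)]
      ring
    · simp only [cosProd, inner_smul_right, mul_assoc]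
  -- If the target density is not positive, a single cosine with empty $\Gamma$ suffices. This
  -- covers $g\equiv0$ and any division by $\mu=0$.
  rcases le_or_gt (2 * surfaceMean K g / polarSup K ν g - ε) 0 with hc | hc
  · have : Nonempty (Fin d) := ⟨⟨0, by omega⟩⟩
    obtain ⟨x, hx⟩ : (frontier K).Nonempty := by
      refine nonempty_frontier_iff.2 ⟨hK_int.mono interior_subset, fun h => ?_⟩
      exact noncompact_univ (EuclideanSpace ℝ (Fin d)) (h ▸ hK_compact)
    obtain ⟨R, hR⟩ := (isCompact_polarBody h0).isBounded.exists_norm_le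
    have hgx := hg_nonneg x hx
    refine hform 1 (|R| * g x + 1)⁻¹ (fun _ => x) one_pos (by positivity) (fun _ => hx) ?_
      ⟨fun _ => 1, ∅, continuous_const, rfl, ⟨isClosed_empty, by simp⟩, Set.empty_subset _, ?_⟩
    · intro y hy
      rw [inv_mul_le_iff₀ (by positivity)]
      have h1 : |⟪ν x, y⟫| ≤ |R| := by
        refine (abs_real_inner_le_norm _ _).trans ?_
        rw [(hν x hx).1, one_mul]
        exact (hR y hy).trans (le_abs_self _)
      have h2 : |⟪ν x, y⟫| * g x ≤ |R| * g x := by gcongr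
      simp
      linarith
    · rw [ENNReal.ofReal_of_nonpos hc]
      exact zero_le
  · set a := surfaceMean K g with ha
    set μ := polarSup K ν g with hμ
    have hratio : 0 < a / μ := by
      rw [mul_div_assoc] at hc
      linarith
    have ha0 : 0 ≤ a := by
      refine integral_nonneg_of_ae ?_
      refine Measure.smul_absolutelyContinuous.ae_le ?_
      filter_upwards [ae_restrict_mem isClosed_frontier.measurableSet] with x hx
        using hg_nonneg x hx
    have hμ0 : 0 < μ := by
      by_contra h
      exact absurd (div_nonpos_of_nonneg_of_nonpos ha0 (not_lt.1 h)) (not_le.2 hratio)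
    -- An infinite or zero surface measure has real value $0$, which would force $\mu=0$.
    have hfin : (μHE[d - 1] : Measure (EuclideanSpace ℝ (Fin d))).real (frontier K) ≠ 0 := by
      intro h
      rw [hμ, polarSup, h, inv_zero, zero_mul] at hμ0
      exact lt_irrefl _ hμ0
    obtain ⟨η, hη0, hη⟩ : ∃ η : ℝ, 0 < η ∧ 2 * a / μ - ε < 2 * (μ + η)⁻¹ * (a - η) := by
      have hcont : ContinuousAt (fun η : ℝ => 2 * (μ + η)⁻¹ * (a - η)) 0 := by
        have : μ + 0 ≠ 0 := by simpa using hμ0.ne'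
        fun_prop (disch := assumption)
      have hlt : 2 * a / μ - ε < 2 * (μ + 0)⁻¹ * (a - 0) := by
        rw [add_zero, sub_zero, mul_right_comm, ← div_eq_mul_inv]
        linarith
      obtain ⟨η, h1, h2⟩ := (((hcont.eventually (lt_mem_nhds hlt)).filter_mono
        (nhdsWithin_le_nhds (s := Set.Ioi 0))).and self_mem_nhdsWithin).exists
      exact ⟨η, h2, h1⟩
    obtain ⟨N, p, hN, hp, hpp, hmean, hsup⟩ :=
      exists_sample_points hd hKc hK_compact h0 hν hg_cont hg_nonneg hfin hη0
    have hα : 0 < (μ + η)⁻¹ := by positivity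
    refine hform N (μ + η)⁻¹ p hN hα hp (fun y hy => ?_) ?_
    · rw [inv_mul_le_iff₀ (by positivity), mul_one]
      exact hsup y hy
    · refine exists_grid_in_zeros (by omega) hK_strict hK_compact.isClosed hK_symm hν hg_nonneg hN
        hα hp hpp hc (hη.trans ?_)
      gcongr
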